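/- Let $n,m$ be integers with $0<m<n$, let $R>0$, $k_1>0$, $M\in\mathbb R$, and write $C_r=(-r,r)^n$, $\bar C_r=[-r,r]^n$. A Gaussian random field $F=(f_1,\dots,f_m):C_{R+1}\to\mathbb R^m$ on a probability space $(\Omega,\mathfrak S,\mathcal P)$ (all finite-dimensional distributions are Gaussian), with covariance kernel $K_{i_1i_2}(x,y)=\mathcal E\big(f_{i_1}(x)f_{i_2}(y)\big)$, is said to satisfy the $(R;M,k_1)$-assumptions if (A1) $\mathcal E(f_i(x))=0$ for all $i$ and all $x\in C_{R+1}$, and for every $x\in C_{R+1}$ the vector $(F(x),\nabla F(x))$ of all $f_i(x)$ and $\partial_jf_i(x)$ is Gaussian and satisfies $$\mathcal E\Big(\Big|\sum_{i=1}^m\eta_i f_i(x)+\sum_{i=1}^m\sum_{j=1}^n\xi_{ij}\,\partial_jf_i(x)\Big|^2\Big)\ \ge\ k_1$$ for all $\eta\in\mathbb R^m$, $\xi\in\mathbb R^{m\times n}$ with $\|\eta\|^2+\|\xi\|^2=1$; (A2) almost surely $F\in C^{3-}(C_{R+1})=\bigcap_{0<\beta<1}C^{2+\beta}(C_{R+1})$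 (the second derivatives are $\beta$-Hölder on compact subsets of $C_{R+1}$ for every $\beta\in(0,1)$), the derivatives $D_x^\alpha D_y^\alpha K_{i_1i_2}$ with $|\alpha|\le 3$ exist on $C_{R+1}\times C_{R+1}$, and $$\max_{0\le|\alpha|\le3}\ \sup_{x\in C_{R+1}}\big|D_x^\alpha D_y^\alpha K_{i_1i_2}(x,y)|_{y=x}\big|\le M,\qquad i_1,i_2=1,\dots,m.$$ For a map $G=(g_1,\dots,g_m)$ differentiable at $x$ put $\lambda(G(x))=\min_{w\in\mathbb S^{m-1}}\|\nabla(G\cdot w)(x)\|$; equivalently, $\lambda(G(x))\ge0$ and $\lambda(G(x))^2$ is the smallest eigenvalue of the $m\times m$ matrix $(\nabla G(x))^T\nabla G(x)=(\nabla g_{i}(x)\cdot\nabla g_{j}(x))_{i,j}$. Then for every $\delta>0$ there is a $\tau=\tau(\delta,R,n,m,M,k_1)\in(0,1/2)$ such that every Gaussian random field $F:C_{R+1}\to\mathbb R^m$ satisfying the $(R;M,k_1)$-assumptions satisfies $$\mathcal P\Big(\min_{x\in\bar C_R}\max\{\|F(x)\|,\lambda(F(x))\}<\tau\Big)<\delta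 .$$ -/

import Mathlib

open MeasureTheory ProbabilityTheory
open scoped NNReal

noncomputable section

namespace GaussianField

/-- The open cube `C_R = (-R, R)^n`. -/
def openCube (n : ℕ) (R : ℝ) : Set (EuclideanSpace ℝ (Fin n)) :=
  {x | ∀ i, x i ∈ Set.Ioo (-R) R}

/-- The closed cube `[-R, R]^n`. -/
def closedCube (n : ℕ) (R : ℝ) : Set (EuclideanSpace ℝ (Fin n)) :=
  {x | ∀ i, x i ∈ Set.Icc (-R) R}

/-- The partial derivative `∂_j g (x)` of a real function of `n` variables. -/
def pderiv {n : ℕ} (j : Fin n) (g : EuclideanSpace ℝ (Fin n) → ℝ)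
    (x : EuclideanSpace ℝ (Fin n)) : ℝ :=
  lineDeriv ℝ g x (EuclideanSpace.single j 1)

/-- The iterated partial derivative `∂_{a₁} ∂_{a₂} ⋯ ∂_{aₖ} g` along the word `a = [a₁, …, aₖ]`.
The words of length `k` run through all multi-indices `α` with `|α| = k`. -/
def iterPDeriv {n : ℕ} : List (Fin n) → (EuclideanSpace ℝ (Fin n) → ℝ) →
    EuclideanSpace ℝ (Fin n) → ℝ
  | [], g => g
  | j :: a, g => pderiv j (iterPDeriv a g)

/-- All the partial derivatives taken in `iterPDeriv a g` exist at the points of `U`. -/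
def HasIterPDeriv {n : ℕ} (U : Set (EuclideanSpace ℝ (Fin n))) :
    List (Fin n) → (EuclideanSpace ℝ (Fin n) → ℝ) → Prop
  | [], _ => True
  | j :: a, g => HasIterPDeriv U a g ∧
      ∀ x ∈ U, LineDifferentiableAt ℝ (iterPDeriv a g) x (EuclideanSpace.single j 1)

/-- `G` is of class `C^{2+β}` in the open set `U`: it is `C²` there and its second derivative is
`β`-Hölder on the compact subsets of `U`. -/
def IsC2Holder {n m : ℕ} (β : ℝ≥0)
    (G : EuclideanSpace ℝ (Fin n) → EuclideanSpace ℝ (Fin m))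
    (U : Set (EuclideanSpace ℝ (Fin n))) : Prop :=
  ContDiffOn ℝ 2 G U ∧
    ∀ K ⊆ U, IsCompact K → ∃ C : ℝ≥0, HolderOnWith C β (iteratedFDeriv ℝ 2 G) K

/-- `C^{3-} = ⋂_{0 < β < 1} C^{2+β}`. -/
def IsC3Minus {n m : ℕ} (G : EuclideanSpace ℝ (Fin n) → EuclideanSpace ℝ (Fin m))
    (U : Set (EuclideanSpace ℝ (Fin n))) : Prop :=
  ∀ β : ℝ≥0, 0 < β → β < 1 → IsC2Holder β G U

/-- The covariance kernel `K_{i₁ i₂}(x, y) = E (f_{i₁}(x) f_{i₂}(y))` of `F = (f_1, …, f_m)`. -/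
def covKernel {Ω : Type*} [MeasurableSpace Ω] (P : Measure Ω) {n m : ℕ}
    (F : Ω → EuclideanSpace ℝ (Fin n) → EuclideanSpace ℝ (Fin m)) (i₁ i₂ : Fin m)
    (x y : EuclideanSpace ℝ (Fin n)) : ℝ :=
  ∫ ω, F ω x i₁ * F ω y i₂ ∂P

/-- The `(R; M, k₁)`-assumptions for a Gaussian random field `F : C_{R+1} → ℝ^m`. The values of
`F` outside the open cube `C_{R+1}` play no role. -/
structure Assumptions {Ω : Type*} [MeasurableSpace Ω] (P : Measure Ω) {n m : ℕ}
    (F : Ω → EuclideanSpace ℝ (Fin n) → EuclideanSpace ℝ (Fin m)) (R M k₁ : ℝ) : Prop where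
  /-- All finite-dimensional distributions of `F` on `C_{R+1}` are Gaussian. -/
  gaussian : IsGaussianProcess (fun (x : openCube n (R + 1)) (ω : Ω) ↦ F ω x) P
  /-- `F` is centered. -/
  centered : ∀ x ∈ openCube n (R + 1), ∀ i, ∫ ω, F ω x i ∂P = 0
  /-- The value and the Jacobian at a point form a Gaussian vector. -/
  jointGaussian : ∀ x ∈ openCube n (R + 1),
    HasGaussianLaw (fun ω ↦ ((fun i ↦ F ω x i : Fin m → ℝ),
      (fun i j ↦ pderiv j (fun y ↦ F ω y i) x : Fin m → Fin n → ℝ))) P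
  /-- This Gaussian vector is non-degenerate, with the uniform lower bound `k₁`. -/
  nondegenerate : 0 < k₁ ∧ ∀ x ∈ openCube n (R + 1),
    ∀ (η : Fin m → ℝ) (ξ : Fin m → Fin n → ℝ),
      ∑ i, η i ^ 2 + ∑ i, ∑ j, ξ i j ^ 2 = 1 →
      k₁ ≤ ∫ ω, |∑ i, η i * F ω x i +
        ∑ i, ∑ j, ξ i j * pderiv j (fun y ↦ F ω y i) x| ^ 2 ∂P
  /-- The sample paths are almost surely `C^{3-}`. -/
  smooth : ∀ᵐ ω ∂P, IsC3Minus (F ω) (openCube n (R + 1))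
  /-- For `|α| ≤ 3` the derivatives `D_x^α D_y^α K_{i₁ i₂}` exist on `C_{R+1} × C_{R+1}`. -/
  kernelDeriv : ∀ a : List (Fin n), a.length ≤ 3 → ∀ i₁ i₂ : Fin m,
    (∀ x ∈ openCube n (R + 1),
      HasIterPDeriv (openCube n (R + 1)) a (covKernel P F i₁ i₂ x)) ∧
    (∀ y ∈ openCube n (R + 1),
      HasIterPDeriv (openCube n (R + 1)) a (fun x ↦ iterPDeriv a (covKernel P F i₁ i₂ x) y))
  /-- On the diagonal these derivatives are bounded by `M`. -/
  kernelBound : ∀ a : List (Fin n), a.length ≤ 3 → ∀ i₁ i₂ : Fin m,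
    ∀ x ∈ openCube n (R + 1),
      |iterPDeriv a (fun x' ↦ iterPDeriv a (covKernel P F i₁ i₂ x') x) x| ≤ M

/-- `λ(G(x)) = min_{w ∈ S^{m-1}} ‖∇(G · w)(x)‖`, whose square is the smallest eigenvalue of the
`m × m` matrix `(∇g_i(x) · ∇g_j(x))`. -/
def lam {n m : ℕ} (G : EuclideanSpace ℝ (Fin n) → EuclideanSpace ℝ (Fin m))
    (x : EuclideanSpace ℝ (Fin n)) : ℝ :=
  sInf ((fun w : EuclideanSpace ℝ (Fin m) ↦ ‖gradient (fun y ↦ inner ℝ (G y) w) x‖) ''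
    Metric.sphere 0 1)

end GaussianField

end

open Filter Topology

noncomputable section

namespace GaussianField

/-! ### Centered Gaussian variables, their almost sure limits and their moments -/

section CenteredGaussian

variable {Ω : Type*} [MeasurableSpace Ω] {P : Measure Ω}

/-! The bad event asks for a point `x` (`n` parameters) and a direction `w` in the unit sphere (`m -
1` parameters) at which the `m + n` numbers `f_i(x)` and `∂_j(F · w)(x)` are all small. There is one
condition more than there are parameters. Discretize with step `h`: there are about `h^{-(m+n-1)}`
pairs (grid point, net vector), and by nondegeneracy each pair is bad at level `ε` with probability
at most a constant times `ε^{m+n}` (`measure_forall_abs_le_le`). If `ε` is only slightly larger than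
`h`, the union bound still tends to zero.

Passing from the grid to all points is a chaining argument. With `u = 2^{-k}` and `N = 2(m+n)`, the
`k`-th grid has step `h = u^N` and level `ε = u^{N-1} = h/u`. The kernel bounds make increments of
`F` and `∇F` between neighbouring grid points of size `h` in mean square
(`Assumptions.integral_sub_sq_le`), so exceeding `ε` is rare: Gaussian variables have moments of
every order, and a high enough one beats the number of grid points, leaving a factor `u`. Summed
over all levels `k ≥ K`, these probabilities are of order `2^{-K}`, and off the exceptional events
the values at `x` differ from those at a point of the `K`-th grid by at most `2ε`. A similar tail
bound gives `|∂_j f_i| ≤ 1/u` on the grid, so replacing the direction by a net vector costs at most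
`h/u = ε` per component. The deterministic part is `le_sInf_of_notMem`.

The probabilistic input is that the field and its derivatives up to order two lie in one space of
centered Gaussian variables, being iterated almost sure limits of difference quotients. There almost
sure convergence implies convergence in mean square, so derivatives commute with expectations and
the variances of the derivatives are the diagonal kernel derivatives bounded by `M`. -/

/-- A centered real Gaussian random variable, possibly degenerate. -/
def IsCenteredGaussian (X : Ω → ℝ) (P : Measure Ω) : Prop :=
  HasGaussianLaw X P ∧ ∫ ω, X ω ∂P = 0

lemma IsCenteredGaussian.map_eq {X : Ω → ℝ} (h : IsCenteredGaussian X P) :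
    P.map X = gaussianReal 0 (∫ ω, X ω ^ 2 ∂P).toNNReal := by
  rw [h.1.map_eq_gaussianReal, h.2, variance_of_integral_eq_zero h.1.aemeasurable h.2]

lemma IsCenteredGaussian.charFun_eq {X : Ω → ℝ} (h : IsCenteredGaussian X P) (t : ℝ) :
    charFun (P.map X) t = Real.exp (-(t ^ 2 * ∫ ω, X ω ^ 2 ∂P) / 2) := by
  rw [h.map_eq, charFun_gaussianReal]
  have h0 : 0 ≤ ∫ ω, X ω ^ 2 ∂P := integral_nonneg fun ω ↦ sq_nonneg _
  push_cast [Real.coe_toNNReal _ h0]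
  congr 1
  ring

lemma isCenteredGaussian_of_map_eq [IsProbabilityMeasure P] {X : Ω → ℝ} {v : ℝ≥0}
    (hX : AEMeasurable X P) (h : P.map X = gaussianReal 0 v) :
    IsCenteredGaussian X P ∧ ∫ ω, X ω ^ 2 ∂P = v := by
  have h1 : HasGaussianLaw X P := ⟨by rw [h]; infer_instance⟩
  have h2 : ∫ ω, X ω ∂P = 0 := by
    have := integral_map (f := id) hX (by fun_prop)
    rw [h] at this
    simpa using this.symm
  refine ⟨⟨h1, h2⟩, ?_⟩
  rw [← variance_of_integral_eq_zero hX h2]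
  have := variance_map (X := id) (Y := X) (μ := P) (by fun_prop) hX
  rw [h] at this
  simpa using this.symm

lemma IsCenteredGaussian.memLp_two {X : Ω → ℝ} (h : IsCenteredGaussian X P) : MemLp X 2 P :=
  h.1.memLp_two

lemma tendsto_charFun_map [IsProbabilityMeasure P] {u : ℕ → Ω → ℝ} {X : Ω → ℝ}
    (hu : ∀ k, AEMeasurable (u k) P)
    (h : ∀ᵐ ω ∂P, Tendsto (fun k ↦ u k ω) atTop (𝓝 (X ω))) (t : ℝ) :
    Tendsto (fun k ↦ charFun (P.map (u k)) t) atTop (𝓝 (charFun (P.map X) t)) := by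
  have hX : AEMeasurable X P := aemeasurable_of_tendsto_metrizable_ae atTop hu h
  have key : ∀ Y : Ω → ℝ, AEMeasurable Y P →
      charFun (P.map Y) t = ∫ ω, Complex.exp (t * Y ω * Complex.I) ∂P := by
    intro Y hY
    rw [charFun_apply_real, integral_map hY (by fun_prop)]
  simp_rw [key X hX, fun k ↦ key (u k) (hu k)]
  refine tendsto_integral_of_dominated_convergence (fun _ ↦ (1 : ℝ)) (fun k ↦ ?_)
    (integrable_const _) (fun k ↦ ?_) ?_
  · have := hu k
    exact AEMeasurable.aestronglyMeasurable (by fun_prop)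
  · filter_upwards with ω
    rw [← Complex.ofReal_mul, Complex.norm_exp_ofReal_mul_I]
  · filter_upwards [h] with ω hω
    have : Continuous fun y : ℝ ↦ Complex.exp (t * y * Complex.I) := by fun_prop
    exact (this.tendsto _).comp hω

/-- Centered Gaussian variables are closed under almost sure limits, and the variances converge. -/
lemma IsCenteredGaussian.of_tendsto [IsProbabilityMeasure P] {u : ℕ → Ω → ℝ} {X : Ω → ℝ}
    (hu : ∀ k, IsCenteredGaussian (u k) P)
    (h : ∀ᵐ ω ∂P, Tendsto (fun k ↦ u k ω) atTop (𝓝 (X ω))) :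
    IsCenteredGaussian X P ∧
      Tendsto (fun k ↦ ∫ ω, u k ω ^ 2 ∂P) atTop (𝓝 (∫ ω, X ω ^ 2 ∂P)) := by
  have hum : ∀ k, AEMeasurable (u k) P := fun k ↦ (hu k).1.aemeasurable
  have hX : AEMeasurable X P := aemeasurable_of_tendsto_metrizable_ae atTop hum h
  have hP : IsProbabilityMeasure (P.map X) := Measure.isProbabilityMeasure_map hX
  have hcf := tendsto_charFun_map hum h
  simp_rw [fun k ↦ (hu k).charFun_eq] at hcf
  -- Convergence of the variances is not assumed. They are recovered from the modulus of the
  -- characteristic function at one point `s ≠ 0` where the limit does not vanish, as `-2 / s ^ 2`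
  -- times its logarithm.
  obtain ⟨s, hs0, hs⟩ : ∃ s : ℝ, s ≠ 0 ∧ charFun (P.map X) s ≠ 0 := by
    have hc : Continuous (charFun (P.map X)) := continuous_charFun
    have h1 : ∀ᶠ s in 𝓝 (0 : ℝ), charFun (P.map X) s ≠ 0 :=
      hc.continuousAt.eventually_ne (by simp)
    have h2 : ∀ᶠ s in 𝓝[≠] (0 : ℝ), s ≠ 0 ∧ charFun (P.map X) s ≠ 0 :=
      (eventually_mem_nhdsWithin).and (h1.filter_mono nhdsWithin_le_nhds)
    exact h2.exists
  have hn := (hcf s).norm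
  simp only [Complex.norm_real, Real.norm_eq_abs, Real.abs_exp] at hn
  have hl := ((Real.continuousAt_log (norm_ne_zero_iff.mpr hs)).tendsto.comp hn).const_mul
    (-2 / s ^ 2)
  simp only [Function.comp_def, Real.log_exp] at hl
  set v : ℝ := -2 / s ^ 2 * Real.log ‖charFun (P.map X) s‖ with hv
  have hlim : Tendsto (fun k ↦ ∫ ω, u k ω ^ 2 ∂P) atTop (𝓝 v) := by
    refine hl.congr fun k ↦ ?_
    field_simp
  have hv0 : 0 ≤ v := ge_of_tendsto' hlim fun k ↦ integral_nonneg fun ω ↦ sq_nonneg _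
  have hmap : P.map X = gaussianReal 0 v.toNNReal := by
    refine Measure.ext_of_charFun ?_
    ext t
    refine tendsto_nhds_unique (hcf t) ?_
    have hc : Continuous fun y : ℝ ↦ ((Real.exp (-(t ^ 2 * y) / 2) : ℝ) : ℂ) := by fun_prop
    have := (hc.tendsto v).comp hlim
    rw [charFun_gaussianReal, Real.coe_toNNReal _ hv0]
    convert this using 2
    push_cast
    congr 1
    simp
    ring_nf
  obtain ⟨h1, h2⟩ := isCenteredGaussian_of_map_eq hX hmap
  refine ⟨h1, ?_⟩
  rwa [h2, Real.coe_toNNReal _ hv0]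

/-- The space of almost sure limits of sequences of elements of `S`. -/
def limSpace (P : Measure Ω) (S : Submodule ℝ (Ω → ℝ)) : Submodule ℝ (Ω → ℝ) where
  carrier := {X | ∃ u : ℕ → Ω → ℝ, (∀ k, u k ∈ S) ∧
    ∀ᵐ ω ∂P, Tendsto (fun k ↦ u k ω) atTop (𝓝 (X ω))}
  zero_mem' := ⟨fun _ ↦ 0, fun _ ↦ S.zero_mem, by simp⟩
  add_mem' := by
    rintro X Y ⟨u, hu, hu'⟩ ⟨w, hw, hw'⟩
    refine ⟨fun k ↦ u k + w k, fun k ↦ S.add_mem (hu k) (hw k), ?_⟩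
    filter_upwards [hu', hw'] with ω h1 h2 using h1.add h2
  smul_mem' := by
    rintro c X ⟨u, hu, hu'⟩
    refine ⟨fun k ↦ c • u k, fun k ↦ S.smul_mem c (hu k), ?_⟩
    filter_upwards [hu'] with ω h1 using h1.const_smul c

lemma mem_limSpace_of_tendsto {S : Submodule ℝ (Ω → ℝ)} {u : ℕ → Ω → ℝ} {X : Ω → ℝ}
    (hu : ∀ k, u k ∈ S) (h : ∀ᵐ ω ∂P, Tendsto (fun k ↦ u k ω) atTop (𝓝 (X ω))) :
    X ∈ limSpace P S := ⟨u, hu, h⟩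

lemma le_limSpace (S : Submodule ℝ (Ω → ℝ)) : S ≤ limSpace P S :=
  fun X hX ↦ ⟨fun _ ↦ X, fun _ ↦ hX, by simp⟩

/-- All elements of `S` are centered Gaussian variables. -/
def IsGaussianSpace (P : Measure Ω) (S : Submodule ℝ (Ω → ℝ)) : Prop :=
  ∀ X ∈ S, IsCenteredGaussian X P

lemma IsGaussianSpace.limSpace [IsProbabilityMeasure P] {S : Submodule ℝ (Ω → ℝ)}
    (h : IsGaussianSpace P S) : IsGaussianSpace P (limSpace P S) := by
  rintro X ⟨u, hu, hu'⟩
  exact (IsCenteredGaussian.of_tendsto (fun k ↦ h _ (hu k)) hu').1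

lemma norm_integral_mul_le {Z W : Ω → ℝ} (hZ : MemLp Z 2 P) (hW : MemLp W 2 P) :
    ‖∫ ω, Z ω * W ω ∂P‖ ≤ √(∫ ω, Z ω ^ 2 ∂P) * √(∫ ω, W ω ^ 2 ∂P) := by
  calc ‖∫ ω, Z ω * W ω ∂P‖ ≤ ∫ ω, ‖Z ω * W ω‖ ∂P := norm_integral_le_integral_norm _
    _ = ∫ ω, ‖Z ω‖ * ‖W ω‖ ∂P := by simp_rw [norm_mul]
    _ ≤ (∫ ω, ‖Z ω‖ ^ (2 : ℝ) ∂P) ^ (1 / (2 : ℝ)) * (∫ ω, ‖W ω‖ ^ (2 : ℝ) ∂P) ^ (1 / (2 : ℝ)) :=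
        integral_mul_norm_le_Lp_mul_Lq Real.HolderConjugate.two_two (by simpa using hZ)
          (by simpa using hW)
    _ = _ := by simp [Real.sqrt_eq_rpow]

/-- In a Gaussian space almost sure convergence implies weak convergence in `L²`. -/
lemma IsGaussianSpace.tendsto_integral_mul [IsProbabilityMeasure P] {S : Submodule ℝ (Ω → ℝ)}
    (hS : IsGaussianSpace P S) {u : ℕ → Ω → ℝ} {X Z : Ω → ℝ} (hu : ∀ k, u k ∈ S) (hX : X ∈ S)
    (hZ : MemLp Z 2 P) (h : ∀ᵐ ω ∂P, Tendsto (fun k ↦ u k ω) atTop (𝓝 (X ω))) :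
    Tendsto (fun k ↦ ∫ ω, Z ω * u k ω ∂P) atTop (𝓝 (∫ ω, Z ω * X ω ∂P)) := by
  -- The differences `u k - X` are themselves centered Gaussian and tend to `0`, so their variances
  -- tend to `0`; Cauchy–Schwarz does the rest.
  have h0 := (IsCenteredGaussian.of_tendsto (X := fun _ ↦ 0) (u := fun k ↦ u k - X) (P := P)
    (fun k ↦ hS _ (S.sub_mem (hu k) hX))
    (by filter_upwards [h] with ω hω; simpa using hω.sub_const (X ω))).2
  simp only [Pi.sub_apply, ne_eq, OfNat.ofNat_ne_zero, not_false_eq_true, zero_pow,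
    integral_zero] at h0
  rw [tendsto_iff_norm_sub_tendsto_zero]
  have hXL := (hS X hX).memLp_two
  have hb : ∀ k, ‖∫ ω, Z ω * u k ω ∂P - ∫ ω, Z ω * X ω ∂P‖ ≤
      √(∫ ω, Z ω ^ 2 ∂P) * √(∫ ω, (u k ω - X ω) ^ 2 ∂P) := by
    intro k
    have huL := (hS _ (hu k)).memLp_two
    have h1 : Integrable (fun ω ↦ Z ω * u k ω) P := hZ.integrable_mul huL
    have h2 : Integrable (fun ω ↦ Z ω * X ω) P := hZ.integrable_mul hXL
    rw [← integral_sub h1 h2]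
    have := norm_integral_mul_le hZ (huL.sub hXL)
    simpa only [Pi.sub_apply, mul_sub] using this
  refine squeeze_zero (fun _ ↦ norm_nonneg _) hb ?_
  have := (Real.continuous_sqrt.tendsto 0).comp h0
  simpa using this.const_mul (√(∫ ω, Z ω ^ 2 ∂P))

/-- Absolute moments of a centered Gaussian variable are controlled by its variance. -/
lemma IsCenteredGaussian.lintegral_pow_le {X : Ω → ℝ} {M : ℝ}
    (h : IsCenteredGaussian X P) (hM : ∫ ω, X ω ^ 2 ∂P ≤ M) (q : ℕ) :
    ∫⁻ ω, ENNReal.ofReal (|X ω| ^ q) ∂P ≤ ENNReal.ofReal (2 * q.factorial * Real.exp (M / 2)) := by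
  have hX := h.1.aemeasurable
  have h0 : 0 ≤ ∫ ω, X ω ^ 2 ∂P := integral_nonneg fun ω ↦ sq_nonneg _
  -- Only `t = ±1` matters, because `|x| ^ q ≤ q! (e^x + e^{-x})`.
  have hmgf : ∀ t : ℝ, t ^ 2 = 1 → ∫ ω, Real.exp (t * X ω) ∂P ≤ Real.exp (M / 2) ∧
      Integrable (fun ω ↦ Real.exp (t * X ω)) P := by
    intro t ht
    have := mgf_gaussianReal h.map_eq t
    have hi : Integrable (fun ω ↦ Real.exp (t * X ω)) P := by
      have := integrable_exp_mul_gaussianReal (μ := 0) (v := (∫ ω, X ω ^ 2 ∂P).toNNReal) t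
      rw [← h.map_eq] at this
      exact this.comp_aemeasurable hX
    refine ⟨?_, hi⟩
    rw [mgf] at this
    rw [this, Real.coe_toNNReal _ h0, ht]
    gcongr
    linarith
  obtain ⟨h1, i1⟩ := hmgf 1 (by norm_num)
  obtain ⟨h2, i2⟩ := hmgf (-1) (by norm_num)
  have hpt : ∀ x : ℝ, |x| ^ q ≤ q.factorial * (Real.exp (1 * x) + Real.exp (-1 * x)) := by
    intro x
    have := Real.pow_div_factorial_le_exp |x| (abs_nonneg x) q
    rw [div_le_iff₀ (by positivity)] at this
    have h3 : Real.exp |x| ≤ Real.exp (1 * x) + Real.exp (-1 * x) := by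
      rcases abs_cases x with h | h <;> rw [h.1] <;> simp [Real.exp_nonneg]
    nlinarith [Nat.cast_nonneg (α := ℝ) q.factorial]
  calc ∫⁻ ω, ENNReal.ofReal (|X ω| ^ q) ∂P
      ≤ ∫⁻ ω, ENNReal.ofReal (q.factorial * (Real.exp (1 * X ω) + Real.exp (-1 * X ω))) ∂P :=
        lintegral_mono fun ω ↦ ENNReal.ofReal_le_ofReal (hpt _)
    _ = ENNReal.ofReal (∫ ω, q.factorial * (Real.exp (1 * X ω) + Real.exp (-1 * X ω)) ∂P) := by
        have i3 : Integrable (fun ω ↦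
            q.factorial * (Real.exp (1 * X ω) + Real.exp (-1 * X ω))) P := (i1.add i2).const_mul _
        rw [ofReal_integral_eq_lintegral_ofReal i3]
        filter_upwards with ω
        positivity
    _ ≤ _ := by
        refine ENNReal.ofReal_le_ofReal ?_
        rw [integral_const_mul, integral_add i1 i2]
        nlinarith [Nat.cast_nonneg (α := ℝ) q.factorial]

end CenteredGaussian

/-! ### Small ball estimate for Gaussian vectors -/

section SmallBall

/-- Bounding the standard normal density by its maximum `1/√(2π)` leaves an explicit Gaussian
integral. -/
lemma integral_exp_neg_mul_sq_gaussianReal_le {c : ℝ} (hc : 0 < c) :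
    ∫ z, Real.exp (-(c * z ^ 2) / 2) ∂(gaussianReal 0 1) ≤ (√c)⁻¹ := by
  rw [integral_gaussianReal_eq_integral_smul (by simp)]
  have hi : Integrable fun z : ℝ ↦ Real.exp (-(c / 2) * z ^ 2) :=
    integrable_exp_neg_mul_sq (by positivity)
  calc ∫ z, gaussianPDFReal 0 1 z • Real.exp (-(c * z ^ 2) / 2)
      ≤ ∫ z, (√(2 * Real.pi))⁻¹ * Real.exp (-(c / 2) * z ^ 2) := by
        refine integral_mono_of_nonneg ?_ (hi.const_mul _) ?_
        · filter_upwards with z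
          have := gaussianPDFReal_nonneg 0 1 z
          simp only [Pi.zero_apply, smul_eq_mul]
          positivity
        · filter_upwards with z
          have h1 : gaussianPDFReal 0 1 z ≤ (√(2 * Real.pi))⁻¹ := by
            rw [gaussianPDFReal]
            simp only [NNReal.coe_one, mul_one, sub_zero]
            refine mul_le_of_le_one_right (by positivity) ?_
            rw [Real.exp_le_one_iff]
            have := sq_nonneg z
            linarith
          have h2 : -(c * z ^ 2) / 2 = -(c / 2) * z ^ 2 := by ring
          simp only [smul_eq_mul, h2]
          gcongr
    _ = (√c)⁻¹ := by
        rw [integral_const_mul, integral_gaussian, ← Real.sqrt_inv, ← Real.sqrt_mul (by positivity),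
          ← Real.sqrt_inv]
        congr 1
        have := Real.pi_ne_zero
        field_simp

/-- The Gaussian weight is its own Fourier transform. This lets the small ball estimate work with
characteristic functions alone, without a density or an inverse covariance matrix. -/
lemma exp_neg_sq_eq_integral_gaussianReal (x : ℝ) :
    (Real.exp (-(x ^ 2) / 2) : ℂ) = ∫ z, Complex.exp (z * x * Complex.I) ∂(gaussianReal 0 1) := by
  have h := charFun_gaussianReal (μ := 0) (v := 1) x
  rw [charFun_apply_real] at h
  simp_rw [mul_comm (_ : ℂ) (x : ℂ)]
  rw [h]
  push_cast
  congr 1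
  simp
  ring

variable {Ω : Type*} [MeasurableSpace Ω] {P : Measure Ω}

/-- Small ball estimate for a Gaussian vector whose covariance matrix is bounded below by `k`. -/
lemma measure_forall_abs_le_le [IsProbabilityMeasure P] {ι : Type*} [Fintype ι] {X : ι → Ω → ℝ}
    {k ε : ℝ} (hk : 0 < k) (hε : 0 < ε)
    (hX : ∀ z : ι → ℝ, IsCenteredGaussian (fun ω ↦ ∑ a, z a * X a ω) P)
    (hv : ∀ z : ι → ℝ, k * ∑ a, z a ^ 2 ≤ ∫ ω, (∑ a, z a * X a ω) ^ 2 ∂P) :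
    P {ω | ∀ a, |X a ω| ≤ ε} ≤ ENNReal.ofReal ((Real.exp (1 / 2) * (ε / √k)) ^ Fintype.card ι) := by
  classical
  have hXm : ∀ a, AEMeasurable (X a) P := fun a ↦ by
    simpa [Pi.single_apply] using (hX (Pi.single a 1)).1.aemeasurable
  set Y : Ω → ι → ℝ := fun ω a ↦ X a ω with hY
  have hYm : AEMeasurable Y P := aemeasurable_pi_lambda _ hXm
  set μ := P.map Y with hμ
  have : IsProbabilityMeasure μ := Measure.isProbabilityMeasure_map hYm
  set γ : Measure (ι → ℝ) := Measure.pi fun _ ↦ gaussianReal 0 1 with hγ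
  -- the Gaussian weight has small expectation
  have hfub : (∫ x, ∏ a, Real.exp (-((x a / ε) ^ 2) / 2) ∂μ : ℝ) ≤ (ε / √k) ^ Fintype.card ι := by
    -- Each weight is a characteristic function of an independent standard normal `z a`. After
    -- Fubini the inner integral is the characteristic function of `∑ z a / ε * X a`, where the
    -- lower bound on the variance applies and the integral over `z` factorizes.
    have e1 : ((∫ x, ∏ a, Real.exp (-((x a / ε) ^ 2) / 2) ∂μ : ℝ) : ℂ) =
        ∫ x, ∫ z, Complex.exp ((∑ a, z a * (x a / ε) : ℝ) * Complex.I) ∂γ ∂μ := by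
      rw [← integral_complex_ofReal]
      congr 1
      ext x
      push_cast
      have h1 : ∀ a, Complex.exp (-((x a / ε : ℂ) ^ 2) / 2) =
          ∫ z, Complex.exp (z * (x a / ε : ℝ) * Complex.I) ∂(gaussianReal 0 1) := fun a ↦ by
        rw [← exp_neg_sq_eq_integral_gaussianReal]
        push_cast
        rfl
      simp_rw [h1]
      rw [← integral_fintype_prod_eq_prod (μ := fun _ ↦ gaussianReal 0 1)
        (f := fun a (z : ℝ) ↦ Complex.exp (z * (x a / ε : ℝ) * Complex.I))]
      congr 1
      ext z
      rw [← Complex.exp_sum, Finset.sum_mul]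
      push_cast
      rfl
    have e2 : ∫ x, ∫ z, Complex.exp ((∑ a, z a * (x a / ε) : ℝ) * Complex.I) ∂γ ∂μ =
        ∫ z, ∫ x, Complex.exp ((∑ a, z a * (x a / ε) : ℝ) * Complex.I) ∂μ ∂γ := by
      refine integral_integral_swap ?_
      refine Integrable.of_bound (C := 1) (Measurable.aestronglyMeasurable (by fun_prop)) ?_
      filter_upwards with p
      rw [Function.uncurry, Complex.norm_exp_ofReal_mul_I]
    have e3 : ∀ z : ι → ℝ, ∫ x, Complex.exp ((∑ a, z a * (x a / ε) : ℝ) * Complex.I) ∂μ =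
        (Real.exp (-(∫ ω, (∑ a, (z a / ε) * X a ω) ^ 2 ∂P) / 2) : ℂ) := by
      intro z
      have h1 := (hX fun a ↦ z a / ε).charFun_eq 1
      rw [charFun_apply_real, integral_map (hX fun a ↦ z a / ε).1.aemeasurable (by fun_prop)] at h1
      rw [hμ, integral_map hYm (Measurable.aestronglyMeasurable (by fun_prop))]
      simp only [one_pow, one_mul, Complex.ofReal_one] at h1
      rw [← h1]
      congr 1
      ext ω
      congr 3
      exact Finset.sum_congr rfl fun a _ ↦ by rw [hY]; ring
    rw [e2] at e1
    simp_rw [e3] at e1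
    rw [integral_complex_ofReal, Complex.ofReal_inj] at e1
    rw [e1]
    calc ∫ z, Real.exp (-(∫ ω, (∑ a, (z a / ε) * X a ω) ^ 2 ∂P) / 2) ∂γ
        ≤ ∫ z, ∏ a, Real.exp (-((k / ε ^ 2) * z a ^ 2) / 2) ∂γ := by
          refine integral_mono_of_nonneg ?_ ?_ ?_
          · filter_upwards with z
            exact (Real.exp_pos _).le
          · refine Integrable.of_bound (C := 1) (Measurable.aestronglyMeasurable (by fun_prop)) ?_
            filter_upwards with z
            rw [← Real.exp_sum, Real.norm_eq_abs, Real.abs_exp, Real.exp_le_one_iff]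
            refine Finset.sum_nonpos fun a _ ↦ ?_
            have : 0 ≤ k / ε ^ 2 * z a ^ 2 := by positivity
            linarith
          · filter_upwards with z
            rw [← Real.exp_sum, Real.exp_le_exp, ← Finset.sum_div, Finset.sum_neg_distrib,
              ← Finset.mul_sum]
            have := hv fun a ↦ z a / ε
            simp_rw [div_pow] at this
            rw [← Finset.sum_div] at this
            have e : k / ε ^ 2 * ∑ a, z a ^ 2 = k * ((∑ a, z a ^ 2) / ε ^ 2) := by ring
            linarith
      _ = ∏ _a : ι, ∫ z, Real.exp (-((k / ε ^ 2) * z ^ 2) / 2) ∂(gaussianReal 0 1) :=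
          integral_fintype_prod_eq_prod (μ := fun _ ↦ gaussianReal 0 1)
            (f := fun _ (z : ℝ) ↦ Real.exp (-((k / ε ^ 2) * z ^ 2) / 2))
      _ ≤ ∏ _a : ι, (ε / √k) := by
          refine Finset.prod_le_prod (fun _ _ ↦ integral_nonneg fun _ ↦ (Real.exp_pos _).le)
            fun a _ ↦ ?_
          refine (integral_exp_neg_mul_sq_gaussianReal_le (by positivity)).trans_eq ?_
          rw [Real.sqrt_div' _ (by positivity), Real.sqrt_sq hε.le, inv_div]
      _ = _ := by simp [div_pow]
  have hmeas : MeasurableSet {x : ι → ℝ | ∀ a, |x a| ≤ ε} := by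
    simp only [Set.ofPred_forall]
    exact MeasurableSet.iInter fun a ↦ measurableSet_le (by fun_prop) (by fun_prop)
  have hint : Integrable (fun x : ι → ℝ ↦ ∏ a, Real.exp (-((x a / ε) ^ 2) / 2)) μ := by
    refine Integrable.of_bound (C := 1) (Measurable.aestronglyMeasurable (by fun_prop)) ?_
    filter_upwards with z
    rw [← Real.exp_sum, Real.norm_eq_abs, Real.abs_exp, Real.exp_le_one_iff]
    exact Finset.sum_nonpos fun a _ ↦ by have := sq_nonneg (z a / ε); linarith
  calc P {ω | ∀ a, |X a ω| ≤ ε} = μ {x | ∀ a, |x a| ≤ ε} := by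
        rw [hμ, Measure.map_apply_of_aemeasurable hYm hmeas]; rfl
    _ = ENNReal.ofReal (μ.real {x | ∀ a, |x a| ≤ ε}) := by simp
    _ ≤ _ := by
        refine ENNReal.ofReal_le_ofReal ?_
        rw [mul_pow, ← integral_indicator_one hmeas]
        -- On the box `|x a / ε| ≤ 1`, so one factor `exp (1 / 2)` per coordinate raises the weight
        -- to at least `1`.
        calc ∫ x, ({x : ι → ℝ | ∀ a, |x a| ≤ ε}.indicator 1 x : ℝ) ∂μ
            ≤ ∫ x, Real.exp (1 / 2) ^ Fintype.card ι *
                ∏ a, Real.exp (-((x a / ε) ^ 2) / 2) ∂μ := by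
              refine integral_mono_of_nonneg ?_ (hint.const_mul _) ?_
              · filter_upwards with x
                exact Set.indicator_nonneg (fun _ _ ↦ zero_le_one) _
              · filter_upwards with x
                have e : Real.exp (1 / 2) ^ Fintype.card ι * ∏ a, Real.exp (-((x a / ε) ^ 2) / 2) =
                    ∏ a, Real.exp (1 / 2 + -((x a / ε) ^ 2) / 2) := by
                  simp_rw [Real.exp_add, Finset.prod_mul_distrib]
                  simp
                rw [e]
                refine Set.indicator_apply_le' (fun hx ↦ ?_) fun _ ↦ by positivity
                rw [Pi.one_apply, ← Real.exp_sum, Real.one_le_exp_iff]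
                refine Finset.sum_nonneg fun a _ ↦ ?_
                have h1 : |x a / ε| ≤ 1 := by
                  rw [abs_div, abs_of_pos hε]
                  exact div_le_one_of_le₀ (hx a) hε.le
                have := (sq_le_one_iff_abs_le_one _).mpr h1
                linarith
          _ ≤ _ := by
              rw [integral_const_mul]
              gcongr

end SmallBall

/-! ### Iterated partial derivatives on open sets -/

section PartialDerivatives

variable {n : ℕ}

lemma isOpen_openCube (r : ℝ) : IsOpen (openCube n r) := by
  have : openCube n r = ⋂ i, (fun x : EuclideanSpace ℝ (Fin n) ↦ x i) ⁻¹' Set.Ioo (-r) r := by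
    ext x; simp [openCube]
  rw [this]
  exact isOpen_iInter_of_finite fun i ↦ isOpen_Ioo.preimage (by fun_prop)

lemma convex_openCube (r : ℝ) : Convex ℝ (openCube n r) := by
  intro x hx y hy a b ha hb hab i
  exact convex_Ioo (-r) r (hx i) (hy i) ha hb hab

lemma fderiv_apply_eq_sum_pderiv {g : EuclideanSpace ℝ (Fin n) → ℝ} {x : EuclideanSpace ℝ (Fin n)}
    (hg : DifferentiableAt ℝ g x) (v : EuclideanSpace ℝ (Fin n)) :
    fderiv ℝ g x v = ∑ j, v j * pderiv j g x := by
  conv_lhs => rw [← (EuclideanSpace.basisFun (Fin n) ℝ).sum_repr v]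
  simp [pderiv, hg.lineDeriv_eq_fderiv]

lemma ContDiffOn.pderiv {g : EuclideanSpace ℝ (Fin n) → ℝ} {U : Set (EuclideanSpace ℝ (Fin n))}
    (hU : IsOpen U) {k : ℕ} (hg : ContDiffOn ℝ (k + 1 : ℕ) g U) (j : Fin n) :
    ContDiffOn ℝ k (pderiv j g) U := by
  have h1 : ContDiffOn ℝ k (fderiv ℝ g) U := hg.fderiv_of_isOpen hU (by norm_cast)
  refine (h1.clm_apply (contDiffOn_const (c := EuclideanSpace.single j 1))).congr fun x hx ↦ ?_
  have hd : DifferentiableAt ℝ g x :=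
    (hg.contDiffAt (hU.mem_nhds hx)).differentiableAt (by simp)
  exact hd.lineDeriv_eq_fderiv

lemma ContDiffOn.iterPDeriv {g : EuclideanSpace ℝ (Fin n) → ℝ}
    {U : Set (EuclideanSpace ℝ (Fin n))} (hU : IsOpen U) {l : ℕ} (hg : ContDiffOn ℝ l g U) :
    ∀ (a : List (Fin n)) (k : ℕ), k + a.length ≤ l → ContDiffOn ℝ k (iterPDeriv a g) U
  | [], k, h => hg.of_le (by exact_mod_cast h)
  | j :: a, k, h => ContDiffOn.pderiv hU
      (ContDiffOn.iterPDeriv hU hg a (k + 1) (by simp at h; omega)) j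

lemma iterPDeriv_eqOn {f g : EuclideanSpace ℝ (Fin n) → ℝ} {U : Set (EuclideanSpace ℝ (Fin n))}
    (hU : IsOpen U) (h : Set.EqOn f g U) :
    ∀ a : List (Fin n), Set.EqOn (iterPDeriv a f) (iterPDeriv a g) U
  | [] => h
  | _ :: a => fun _ hx ↦
      ((iterPDeriv_eqOn hU h a).eventuallyEq_of_mem (hU.mem_nhds hx)).lineDeriv_eq

lemma eventually_add_smul_mem {U : Set (EuclideanSpace ℝ (Fin n))} (hU : IsOpen U)
    {x : EuclideanSpace ℝ (Fin n)} (hx : x ∈ U) (v : EuclideanSpace ℝ (Fin n)) :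
    ∀ᶠ t : ℝ in 𝓝 0, x + t • v ∈ U := by
  have : Continuous fun t : ℝ ↦ x + t • v := by fun_prop
  exact this.continuousAt.eventually_mem (hU.mem_nhds (by simpa using hx))

end PartialDerivatives

/-! ### Derivatives of the field: Gaussianity, variances and increments -/

section Field

variable {Ω : Type*} [MeasurableSpace Ω] {P : Measure Ω} {n m : ℕ}
  {F : Ω → EuclideanSpace ℝ (Fin n) → EuclideanSpace ℝ (Fin m)} {R M k₁ : ℝ}

/-- The partial derivative along the word `a` of the `i`-th component of the field. -/
def fieldDeriv (F : Ω → EuclideanSpace ℝ (Fin n) → EuclideanSpace ℝ (Fin m)) (a : List (Fin n))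
    (i : Fin m) (x : EuclideanSpace ℝ (Fin n)) (ω : Ω) : ℝ :=
  iterPDeriv a (fun y ↦ F ω y i) x

/-- The linear span of the values of the field. -/
def valueSpace (F : Ω → EuclideanSpace ℝ (Fin n) → EuclideanSpace ℝ (Fin m))
    (U : Set (EuclideanSpace ℝ (Fin n))) : Submodule ℝ (Ω → ℝ) :=
  Submodule.span ℝ (Set.range fun p : U × Fin m ↦ fun ω ↦ F ω p.1 p.2)

/-- A Gaussian space containing the derivatives of the field up to second order. -/
def derivSpace (P : Measure Ω) (F : Ω → EuclideanSpace ℝ (Fin n) → EuclideanSpace ℝ (Fin m))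
    (R : ℝ) (k : ℕ) : Submodule ℝ (Ω → ℝ) :=
  (limSpace P)^[k] (valueSpace F (openCube n (R + 1)))

lemma Assumptions.isGaussianSpace_valueSpace (h : Assumptions P F R M k₁) :
    IsGaussianSpace P (valueSpace F (openCube n (R + 1))) := by
  intro X hX
  rw [valueSpace, Finsupp.mem_span_range_iff_exists_finsupp] at hX
  obtain ⟨c, rfl⟩ := hX
  have hg : IsGaussianProcess (fun (p : openCube n (R + 1) × Fin m) ω ↦ F ω p.1 p.2) P :=
    IsGaussianProcess.of_isGaussianProcess h.gaussian fun p ↦ ⟨{p.1},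
      (EuclideanSpace.proj (𝕜 := ℝ) p.2).comp (ContinuousLinearMap.proj ⟨p.1, by simp⟩),
      fun ω ↦ rfl⟩
  refine ⟨(hg.smul c).hasGaussianLaw_sum, ?_⟩
  simp only [Finsupp.sum, Finset.sum_apply, Pi.smul_apply]
  have hi : ∀ p, Integrable (fun ω ↦ c p • F ω p.1 p.2) P :=
    fun p ↦ (hg.hasGaussianLaw_eval p).integrable.smul (c p)
  rw [integral_finsetSum _ fun p _ ↦ hi p]
  refine Finset.sum_eq_zero fun p _ ↦ ?_
  rw [integral_smul, h.centered _ p.1.2, smul_zero]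

lemma Assumptions.isGaussianSpace [IsProbabilityMeasure P] (h : Assumptions P F R M k₁) (k : ℕ) :
    IsGaussianSpace P (derivSpace P F R k) := by
  induction k with
  | zero => exact h.isGaussianSpace_valueSpace
  | succ k ih =>
    rw [derivSpace, Function.iterate_succ_apply']
    exact ih.limSpace

lemma derivSpace_mono : Monotone (derivSpace P F R) :=
  monotone_nat_of_le_succ fun k ↦ by
    rw [derivSpace, derivSpace, Function.iterate_succ_apply']
    exact le_limSpace _

lemma Assumptions.contDiffOn (h : Assumptions P F R M k₁) :
    ∀ᵐ ω ∂P, ∀ (a : List (Fin n)) (k : ℕ) (i : Fin m), k + a.length ≤ 2 →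
      ContDiffOn ℝ k (fun x ↦ fieldDeriv F a i x ω) (openCube n (R + 1)) := by
  filter_upwards [h.smooth] with ω hω a k i hk
  -- Any `β` in `(0, 1)` would do, since only the `C²` part is kept.
  have h1 : ContDiffOn ℝ (2 : ℕ) (F ω) (openCube n (R + 1)) :=
    (hω (1 / 2) (by norm_num) (by
      rw [← NNReal.coe_lt_coe]; norm_num)).1
  have h2 : ContDiffOn ℝ (2 : ℕ) (fun y ↦ F ω y i) (openCube n (R + 1)) :=
    (contDiffOn_euclidean.mp h1) i
  exact ContDiffOn.iterPDeriv (isOpen_openCube _) h2 a k hk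

/-- Almost sure convergence of the difference quotients. -/
lemma Assumptions.ae_tendsto_slope (h : Assumptions P F R M k₁) {a : List (Fin n)}
    (ha : a.length ≤ 1) (i : Fin m) {x : EuclideanSpace ℝ (Fin n)} (hx : x ∈ openCube n (R + 1))
    (v : EuclideanSpace ℝ (Fin n)) {t : ℕ → ℝ} (ht : Tendsto t atTop (𝓝[≠] 0)) :
    ∀ᵐ ω ∂P, Tendsto
      (fun k ↦ ((t k)⁻¹ • (fieldDeriv F a i (x + t k • v) - fieldDeriv F a i x)) ω) atTop
      (𝓝 ((∑ j, v j • fieldDeriv F (j :: a) i x) ω)) := by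
  filter_upwards [h.contDiffOn] with ω hω
  have hd : DifferentiableAt ℝ (fun x ↦ fieldDeriv F a i x ω) x :=
    ((hω a 1 i (by omega)).contDiffAt ((isOpen_openCube _).mem_nhds hx)).differentiableAt (by simp)
  have h1 := hd.hasFDerivAt.hasLineDerivAt v
  rw [HasLineDerivAt, hasDerivAt_iff_tendsto_slope_zero, fderiv_apply_eq_sum_pderiv hd] at h1
  have h2 := h1.comp ht
  simp only [zero_add, zero_smul, add_zero] at h2
  simp only [Finset.sum_apply, Pi.smul_apply, Pi.sub_apply, smul_eq_mul]
  exact h2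

/-- A derivative is an almost sure limit of difference quotients of the derivative one order lower,
so each differentiation costs one application of `limSpace`. -/
lemma Assumptions.fieldDeriv_mem (h : Assumptions P F R M k₁) (i : Fin m) :
    ∀ (a : List (Fin n)), a.length ≤ 2 → ∀ x ∈ openCube n (R + 1),
      fieldDeriv F a i x ∈ derivSpace P F R a.length := by
  intro a
  induction a with
  | nil => exact fun _ x hx ↦ Submodule.subset_span ⟨(⟨x, hx⟩, i), rfl⟩
  | cons j a ih =>
    intro ha x hx
    have ha' : a.length ≤ 1 := by simpa using ha
    obtain ⟨t, ht⟩ : ∃ t : ℕ → ℝ, Tendsto t atTop (𝓝[≠] 0) := exists_seq_tendsto _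
    set v : EuclideanSpace ℝ (Fin n) := EuclideanSpace.single j 1 with hv
    obtain ⟨N, hN⟩ := eventually_atTop.mp ((ht.mono_right nhdsWithin_le_nhds).eventually
      (eventually_add_smul_mem (isOpen_openCube _) hx v))
    have hlim := h.ae_tendsto_slope ha' i hx v (ht.comp (tendsto_add_atTop_nat N))
    have e : ∑ j', v j' • fieldDeriv F (j' :: a) i x = fieldDeriv F (j :: a) i x := by
      rw [Finset.sum_eq_single j] <;> simp +contextual [hv]
    rw [e] at hlim
    rw [List.length_cons, derivSpace, Function.iterate_succ_apply']
    refine mem_limSpace_of_tendsto (fun k ↦ ?_) hlim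
    exact Submodule.smul_mem _ _
      (Submodule.sub_mem _ (ih (by omega) _ (hN _ (by simp))) (ih (by omega) x hx))

lemma Assumptions.fieldDeriv_mem_two (h : Assumptions P F R M k₁) (i : Fin m) {a : List (Fin n)}
    (ha : a.length ≤ 2) {x : EuclideanSpace ℝ (Fin n)} (hx : x ∈ openCube n (R + 1)) :
    fieldDeriv F a i x ∈ derivSpace P F R 2 :=
  derivSpace_mono ha (h.fieldDeriv_mem i a ha x hx)

/-- Differentiation under the expectation. -/
lemma Assumptions.hasLineDerivAt_integral [IsProbabilityMeasure P] (h : Assumptions P F R M k₁)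
    {a : List (Fin n)} (ha : a.length ≤ 1) (i : Fin m) {Z : Ω → ℝ} (hZ : MemLp Z 2 P)
    {x : EuclideanSpace ℝ (Fin n)} (hx : x ∈ openCube n (R + 1))
    (v : EuclideanSpace ℝ (Fin n)) :
    HasLineDerivAt ℝ (fun y ↦ ∫ ω, Z ω * fieldDeriv F a i y ω ∂P)
      (∫ ω, Z ω * (∑ j, v j • fieldDeriv F (j :: a) i x) ω ∂P) x v := by
  rw [HasLineDerivAt, hasDerivAt_iff_tendsto_slope_zero]
  refine tendsto_of_seq_tendsto fun t ht ↦ ?_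
  -- Convergence in the Gaussian space is about sequences; dropping the first `N` terms keeps all
  -- points inside the cube.
  obtain ⟨N, hN⟩ := eventually_atTop.mp ((ht.mono_right nhdsWithin_le_nhds).eventually
    (eventually_add_smul_mem (isOpen_openCube _) hx v))
  rw [← tendsto_add_atTop_iff_nat N]
  have hS := h.isGaussianSpace 2
  have hm : ∀ k, fieldDeriv F a i (x + t (k + N) • v) ∈ derivSpace P F R 2 := fun k ↦
    h.fieldDeriv_mem_two i (by omega) (hN _ (by simp))
  have hm0 : fieldDeriv F a i x ∈ derivSpace P F R 2 := h.fieldDeriv_mem_two i (by omega) hx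
  have := hS.tendsto_integral_mul (Z := Z)
    (fun k ↦ Submodule.smul_mem _ (t (k + N))⁻¹ (Submodule.sub_mem _ (hm k) hm0))
    (Submodule.sum_mem _ fun j _ ↦ Submodule.smul_mem _ (v j)
      (h.fieldDeriv_mem_two i (a := j :: a) (by simpa using ha) hx)) hZ
    (h.ae_tendsto_slope ha i hx v (ht.comp (tendsto_add_atTop_nat N)))
  refine this.congr fun k ↦ ?_
  have i1 : Integrable (fun ω ↦ Z ω * fieldDeriv F a i (x + t (k + N) • v) ω) P :=
    hZ.integrable_mul (hS _ (hm k)).memLp_two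
  have i2 : Integrable (fun ω ↦ Z ω * fieldDeriv F a i x ω) P :=
    hZ.integrable_mul (hS _ hm0).memLp_two
  simp only [Function.comp_apply, zero_add, zero_smul, add_zero]
  rw [← integral_sub i1 i2, smul_eq_mul, ← integral_const_mul]
  congr 1
  ext ω
  simp
  ring

/-- `Z` is an arbitrary square integrable variable so that the rule can be used once in each
variable of the kernel. -/
lemma Assumptions.iterPDeriv_integral [IsProbabilityMeasure P] (h : Assumptions P F R M k₁)
    (i : Fin m) {Z : Ω → ℝ} (hZ : MemLp Z 2 P) : ∀ a : List (Fin n), a.length ≤ 2 →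
      Set.EqOn (iterPDeriv a fun y ↦ ∫ ω, Z ω * F ω y i ∂P)
        (fun y ↦ ∫ ω, Z ω * fieldDeriv F a i y ω ∂P) (openCube n (R + 1)) := by
  intro a
  induction a with
  | nil => exact fun _ x _ ↦ rfl
  | cons j a ih =>
    intro ha x hx
    have ha' : a.length ≤ 1 := by simpa using ha
    have h1 := h.hasLineDerivAt_integral ha' i hZ hx (EuclideanSpace.single j 1)
    have e : ∑ j', (EuclideanSpace.single j 1 : EuclideanSpace ℝ (Fin n)) j' •
        fieldDeriv F (j' :: a) i x = fieldDeriv F (j :: a) i x := by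
      rw [Finset.sum_eq_single j] <;> simp +contextual
    rw [e] at h1
    rw [iterPDeriv, pderiv, ((ih (by omega)).eventuallyEq_of_mem
      ((isOpen_openCube _).mem_nhds hx)).lineDeriv_eq]
    exact h1.lineDeriv

/-- The variances of the derivatives up to order two are given by the kernel. -/
lemma Assumptions.integral_sq_le [IsProbabilityMeasure P] (h : Assumptions P F R M k₁)
    (i : Fin m) {a : List (Fin n)} (ha : a.length ≤ 2)
    {x : EuclideanSpace ℝ (Fin n)} (hx : x ∈ openCube n (R + 1)) :
    ∫ ω, fieldDeriv F a i x ω ^ 2 ∂P ≤ M := by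
  have hS := h.isGaussianSpace 2
  have hL : ∀ a : List (Fin n), a.length ≤ 2 → ∀ x ∈ openCube n (R + 1),
      MemLp (fieldDeriv F a i x) 2 P :=
    fun a ha x hx ↦ (hS _ (h.fieldDeriv_mem_two i ha hx)).memLp_two
  refine le_trans (le_of_eq ?_) ((le_abs_self _).trans (h.kernelBound a (by omega) i i x hx))
  -- Differentiate in the second variable with `Z = f_i(x')`, then in the first with `Z` the
  -- derivative at `x`: the diagonal kernel derivative is the variance.
  have e1 : Set.EqOn (fun x' ↦ iterPDeriv a (covKernel P F i i x') x)
      (fun x' ↦ ∫ ω, fieldDeriv F a i x ω * F ω x' i ∂P) (openCube n (R + 1)) := by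
    intro x' hx'
    have := h.iterPDeriv_integral i (hL [] (by simp) x' hx') a ha hx
    refine this.trans ?_
    simp only [fieldDeriv, iterPDeriv, mul_comm]
  rw [iterPDeriv_eqOn (isOpen_openCube _) e1 a hx,
    h.iterPDeriv_integral i (hL a ha x hx) a ha hx]
  simp only [sq]

/-- Increments are Lipschitz in mean square. -/
lemma Assumptions.integral_sub_sq_le [IsProbabilityMeasure P] (h : Assumptions P F R M k₁)
    (i : Fin m) {a : List (Fin n)} (ha : a.length ≤ 1) {x y : EuclideanSpace ℝ (Fin n)}
    (hx : x ∈ openCube n (R + 1)) (hy : y ∈ openCube n (R + 1)) {r : ℝ}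
    (hr : ∀ j, |y j - x j| ≤ r) :
    ∫ ω, (fieldDeriv F a i y ω - fieldDeriv F a i x ω) ^ 2 ∂P ≤ (n * r) ^ 2 * M := by
  have hS := h.isGaussianSpace 2
  have hmem : ∀ z ∈ openCube n (R + 1), fieldDeriv F a i z ∈ derivSpace P F R 2 :=
    fun z hz ↦ h.fieldDeriv_mem_two i (by omega) hz
  have hL : ∀ X ∈ derivSpace P F R 2, MemLp X 2 P := fun X hX ↦ (hS X hX).memLp_two
  set Z := fieldDeriv F a i y - fieldDeriv F a i x with hZdef
  have hZ : MemLp Z 2 P := hL _ (Submodule.sub_mem _ (hmem y hy) (hmem x hx))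
  set v := y - x with hv
  have hseg : ∀ t ∈ Set.Icc (0 : ℝ) 1, x + t • v ∈ openCube n (R + 1) := fun t ht ↦
    (convex_openCube _).add_smul_sub_mem hx hy ht
  set W : ℝ → Ω → ℝ := fun t ↦ ∑ j, v j • fieldDeriv F (j :: a) i (x + t • v) with hW
  have hjmem : ∀ t ∈ Set.Icc (0 : ℝ) 1, ∀ j,
      fieldDeriv F (j :: a) i (x + t • v) ∈ derivSpace P F R 2 :=
    fun t ht j ↦ h.fieldDeriv_mem_two i (by simpa using ha) (hseg t ht)
  have hWL : ∀ t ∈ Set.Icc (0 : ℝ) 1, MemLp (W t) 2 P := fun t ht ↦ hL _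
    (Submodule.sum_mem _ fun j _ ↦ Submodule.smul_mem _ _ (hjmem t ht j))
  have hWsq : ∀ t ∈ Set.Icc (0 : ℝ) 1, ∫ ω, W t ω ^ 2 ∂P ≤ (n * r) ^ 2 * M := by
    intro t ht
    have hi : ∀ j, Integrable (fun ω ↦ fieldDeriv F (j :: a) i (x + t • v) ω ^ 2) P :=
      fun j ↦ (hL _ (hjmem t ht j)).integrable_sq
    calc ∫ ω, W t ω ^ 2 ∂P
        ≤ ∫ ω, n * ∑ j, r ^ 2 * fieldDeriv F (j :: a) i (x + t • v) ω ^ 2 ∂P := by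
          refine integral_mono (hWL t ht).integrable_sq
            ((integrable_finsetSum _ fun j _ ↦ (hi j).const_mul _).const_mul _) fun ω ↦ ?_
          simp only [hW, Finset.sum_apply, Pi.smul_apply, smul_eq_mul]
          refine sq_sum_le_card_mul_sum_sq.trans ?_
          rw [Finset.card_univ, Fintype.card_fin]
          refine mul_le_mul_of_nonneg_left (Finset.sum_le_sum fun j _ ↦ ?_) (by positivity)
          rw [mul_pow]
          exact mul_le_mul_of_nonneg_right (sq_le_sq' (abs_le.mp (hr j)).1 (abs_le.mp (hr j)).2)
            (sq_nonneg _)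
      _ = n * ∑ j, r ^ 2 * ∫ ω, fieldDeriv F (j :: a) i (x + t • v) ω ^ 2 ∂P := by
          rw [integral_const_mul, integral_finsetSum _ fun j _ ↦ (hi j).const_mul _]
          simp_rw [integral_const_mul]
      _ ≤ n * ∑ _j : Fin n, r ^ 2 * M := by
          gcongr with j
          exact h.integral_sq_le i (by simpa using ha) (hseg t ht)
      _ = (n * r) ^ 2 * M := by
          simp
          ring
  -- Duality: pair the path with its own increment `Z`. The real function `t ↦ E(Z f(x + t v))`
  -- increases by `E(Z²)` over `[0, 1]`, and Cauchy–Schwarz bounds its derivative.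
  have hmv := norm_image_sub_le_of_norm_deriv_le_segment_01'
    (f := fun t : ℝ ↦ ∫ ω, Z ω * fieldDeriv F a i (x + t • v) ω ∂P)
    (f' := fun t ↦ ∫ ω, Z ω * W t ω ∂P) (C := √(∫ ω, Z ω ^ 2 ∂P) * √((n * r) ^ 2 * M))
    (fun t ht ↦ ?_) (fun t ht ↦ ?_)
  · have e : ∫ ω, Z ω * fieldDeriv F a i (x + (1 : ℝ) • v) ω ∂P -
        ∫ ω, Z ω * fieldDeriv F a i (x + (0 : ℝ) • v) ω ∂P = ∫ ω, Z ω ^ 2 ∂P := by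
      have i1 : Integrable (fun ω ↦ Z ω * fieldDeriv F a i y ω) P :=
        hZ.integrable_mul (hL _ (hmem y hy))
      have i2 : Integrable (fun ω ↦ Z ω * fieldDeriv F a i x ω) P :=
        hZ.integrable_mul (hL _ (hmem x hx))
      simp only [one_smul, zero_smul, add_zero, hv, add_sub_cancel]
      rw [← integral_sub i1 i2]
      congr 1
      ext ω
      rw [hZdef, Pi.sub_apply]
      ring
    have hA : 0 ≤ ∫ ω, Z ω ^ 2 ∂P := integral_nonneg fun ω ↦ sq_nonneg _
    rw [e, Real.norm_of_nonneg hA] at hmv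
    change ∫ ω, Z ω ^ 2 ∂P ≤ _
    have hB : 0 ≤ (n * r) ^ 2 * M := (integral_nonneg fun ω ↦ sq_nonneg _).trans
      (hWsq 0 (by simp))
    have h1 := Real.sq_sqrt hA
    have h2 := Real.sq_sqrt hB
    -- With `A = E(Z²)` and `B = (n r)² M`, the mean value inequality reads `A ≤ √A √B ≤ (A + B) /
    -- 2`, hence `A ≤ B`.
    nlinarith [sq_nonneg (√(∫ ω, Z ω ^ 2 ∂P) - √((n * r) ^ 2 * M))]
  · have h1 := h.hasLineDerivAt_integral ha i hZ (hseg t ht) v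
    rw [HasLineDerivAt] at h1
    rw [← sub_self t] at h1
    have h3 := HasDerivAt.comp_sub_const t t h1
    refine HasDerivAt.hasDerivWithinAt ?_
    refine h3.congr_of_eventuallyEq (Eventually.of_forall fun s ↦ ?_)
    simp only [add_assoc, ← add_smul, add_sub_cancel]
  · refine (norm_integral_mul_le hZ (hWL t (Set.Ico_subset_Icc_self ht))).trans ?_
    gcongr
    exact hWsq t (Set.Ico_subset_Icc_self ht)

end Field

/-! ### Grids in the cube and nets of directions -/

section Grid

/-- The point `h z` of the lattice `h ℤ^n`. -/
def latticePoint {n : ℕ} (h : ℝ) (z : Fin n → ℤ) : EuclideanSpace ℝ (Fin n) :=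
  WithLp.toLp 2 fun i ↦ h * z i

@[simp]
lemma latticePoint_apply {n : ℕ} (h : ℝ) (z : Fin n → ℤ) (i : Fin n) :
    latticePoint h z i = h * z i := rfl

open Classical in
/-- The indices of the points of the lattice `h ℤ^n` in the cube `C_{R+1}`. -/
def grid (n : ℕ) (R h : ℝ) : Finset (Fin n → ℤ) :=
  (Fintype.piFinset fun _ ↦ Finset.Icc (-⌈(R + 1) / h⌉) ⌈(R + 1) / h⌉).filter
    fun z ↦ latticePoint h z ∈ openCube n (R + 1)

/-- There are `2⌈b/h⌉ + 1 ≤ 2b/h + 3` integers, and `h ≤ 1` absorbs the `3`. The free bound `c` lets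
grid and net share the constant `2R + 5`, with `c = R + 1`. -/
lemma card_Icc_ceil_le {b c h : ℝ} (hb : 0 ≤ b) (hbc : b ≤ c) (h0 : 0 < h) (h1 : h ≤ 1) :
    ((Finset.Icc (-⌈b / h⌉) ⌈b / h⌉).card : ℝ) ≤ (2 * c + 3) / h := by
  have hN : 0 ≤ ⌈b / h⌉ := Int.ceil_nonneg (by positivity)
  have h2 : (⌈b / h⌉ : ℝ) < b / h + 1 := Int.ceil_lt_add_one _
  rw [Int.card_Icc]
  have e : ((⌈b / h⌉ + 1 - -⌈b / h⌉).toNat : ℝ) = ⌈b / h⌉ + 1 + ⌈b / h⌉ := by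
    rw [← Int.cast_natCast, Int.toNat_of_nonneg (by omega)]
    push_cast
    ring
  rw [e, le_div_iff₀ h0]
  have h3 : b / h * h = b := div_mul_cancel₀ _ h0.ne'
  nlinarith

lemma card_grid_le (n : ℕ) {R h : ℝ} (hR : 0 < R) (h0 : 0 < h) (h1 : h ≤ 1) :
    ((grid n R h).card : ℝ) ≤ ((2 * R + 5) / h) ^ n := by
  classical
  have h2 : (grid n R h).card ≤ _ := Finset.card_filter_le _ _
  rw [Fintype.card_piFinset_const] at h2
  refine (Nat.cast_le.mpr h2).trans ?_
  push_cast
  refine pow_le_pow_left₀ (by positivity) ?_ n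
  have := card_Icc_ceil_le (b := R + 1) (c := R + 1) (by linarith) le_rfl h0 h1
  exact this.trans_eq (by ring)

lemma mem_openCube_of_mem_grid {n : ℕ} {R h : ℝ} {z : Fin n → ℤ} (hz : z ∈ grid n R h) :
    latticePoint h z ∈ openCube n (R + 1) := by
  classical
  exact (Finset.mem_filter.mp hz).2

/-- The coordinates of `x` rounded down to multiples of `h`. -/
def roundDown {n : ℕ} (h : ℝ) (x : EuclideanSpace ℝ (Fin n)) : Fin n → ℤ := fun i ↦ ⌊x i / h⌋

lemma mul_floor_div_le {h : ℝ} (h0 : 0 < h) (t : ℝ) : h * ⌊t / h⌋ ≤ t := by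
  have := Int.floor_le (t / h)
  rw [le_div_iff₀ h0] at this
  linarith

lemma lt_mul_floor_div_add {h : ℝ} (h0 : 0 < h) (t : ℝ) : t < h * ⌊t / h⌋ + h := by
  have := Int.lt_floor_add_one (t / h)
  rw [div_lt_iff₀ h0] at this
  linarith

/-- Rounding can leave the closed cube, but by less than `h < 1`, so the margin between `C_R` and
`C_{R+1}` suffices. -/
lemma roundDown_mem_grid {n : ℕ} {R h : ℝ} (h0 : 0 < h) (h1 : h < 1)
    {x : EuclideanSpace ℝ (Fin n)} (hx : x ∈ closedCube n R) : roundDown h x ∈ grid n R h := by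
  have hb : ∀ i, -(R + 1) < h * ⌊x i / h⌋ ∧ h * ⌊x i / h⌋ < R + 1 := fun i ↦ by
    have := (hx i).1
    have := (hx i).2
    have := mul_floor_div_le h0 (x i)
    have := lt_mul_floor_div_add h0 (x i)
    constructor <;> linarith
  classical
  rw [grid, Finset.mem_filter, Fintype.mem_piFinset]
  refine ⟨fun i ↦ ?_, fun i ↦ hb i⟩
  rw [Finset.mem_Icc]
  have hc := Int.le_ceil ((R + 1) / h)
  rw [div_le_iff₀ h0] at hc
  obtain ⟨b1, b2⟩ := hb i
  constructor
  · have : (-⌈(R + 1) / h⌉ : ℝ) ≤ ⌊x i / h⌋ := by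
      by_contra! hcon
      nlinarith
    exact_mod_cast this
  · have : (⌊x i / h⌋ : ℝ) ≤ ⌈(R + 1) / h⌉ := by
      by_contra! hcon
      nlinarith
    exact_mod_cast this

lemma tendsto_latticePoint_roundDown {n : ℕ} {h : ℕ → ℝ} (h0 : ∀ k, 0 < h k)
    (h1 : Tendsto h atTop (𝓝 0)) (x : EuclideanSpace ℝ (Fin n)) :
    Tendsto (fun k ↦ latticePoint (h k) (roundDown (h k) x)) atTop (𝓝 x) := by
  have : Tendsto (fun k ↦ fun i ↦ h k * (⌊x i / h k⌋ : ℝ)) atTop (𝓝 x.ofLp) := by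
    rw [tendsto_pi_nhds]
    intro i
    refine tendsto_of_tendsto_of_tendsto_of_le_of_le (g := fun k ↦ x i - h k) (h := fun _ ↦ x i)
      (by simpa using h1.const_sub (x i)) tendsto_const_nhds (fun k ↦ ?_) fun k ↦ ?_
    · have := lt_mul_floor_div_add (h0 k) (x i)
      simp only
      linarith
    · exact mul_floor_div_le (h0 k) (x i)
  exact ((PiLp.continuous_toLp 2 _).tendsto _).comp this

/-- Coefficient vectors with `i₀`-th coordinate `1`, the other ones being multiples of `h`. -/
def netVector {m : ℕ} (h : ℝ) (i₀ : Fin m) (z : Fin m → ℤ) : Fin m → ℝ :=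
  fun i ↦ if i = i₀ then 1 else h * z i

/-- The indices of the vectors `netVector h i₀ z` in the cube `[-1, 1]^m`. -/
def net (m : ℕ) (h : ℝ) (i₀ : Fin m) : Finset (Fin m → ℤ) :=
  Fintype.piFinset fun i ↦ if i = i₀ then {0} else Finset.Icc (-⌈1 / h⌉) ⌈1 / h⌉

/-- The pinned coordinate `i₀` contributes a single value, whence the exponent `m - 1`. This is the
saving that leaves `m + n - 1` parameters against `m + n` conditions. -/
lemma card_net_le {m : ℕ} {R h : ℝ} (hR : 0 < R) (h0 : 0 < h) (h1 : h ≤ 1) (i₀ : Fin m) :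
    ((net m h i₀).card : ℝ) ≤ ((2 * R + 5) / h) ^ (m - 1) := by
  have e : (net m h i₀).card = (Finset.Icc (-⌈1 / h⌉) ⌈1 / h⌉).card ^ (m - 1) := by
    rw [net, Fintype.card_piFinset, ← Finset.mul_prod_erase _ _ (Finset.mem_univ i₀)]
    rw [if_pos rfl, Finset.card_singleton, one_mul, Finset.prod_congr rfl fun i hi ↦ by
      rw [if_neg (Finset.ne_of_mem_erase hi)]]
    simp
  rw [e]
  push_cast
  refine pow_le_pow_left₀ (by positivity) ?_ _
  have := card_Icc_ceil_le (b := 1) (c := R + 1) (by norm_num) (by linarith) h0 h1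
  exact this.trans_eq (by ring)

lemma exists_mem_net {m : ℕ} {h : ℝ} (h0 : 0 < h) (i₀ : Fin m) {v : Fin m → ℝ}
    (hv : ∀ i, |v i| ≤ 1) (hv0 : v i₀ = 1) :
    ∃ z ∈ net m h i₀, ∀ i, |v i - netVector h i₀ z i| ≤ h := by
  refine ⟨fun i ↦ if i = i₀ then 0 else ⌊v i / h⌋, ?_, fun i ↦ ?_⟩
  · rw [net, Fintype.mem_piFinset]
    intro i
    by_cases hi : i = i₀
    · simp [hi]
    · simp only [hi, if_false, Finset.mem_Icc]
      obtain ⟨b1, b2⟩ := abs_le.mp (hv i)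
      constructor
      · rw [← Int.floor_neg]
        refine Int.floor_le_floor ?_
        rw [← neg_div]
        gcongr
      · refine (Int.floor_le_floor ?_).trans (Int.floor_le_ceil _)
        gcongr
  · by_cases hi : i = i₀
    · simp [netVector, hi, hv0, h0.le]
    · simp only [netVector, hi, if_false]
      have := mul_floor_div_le h0 (v i)
      have := lt_mul_floor_div_add h0 (v i)
      rw [abs_le]
      constructor <;> linarith

end Grid

/-! ### Union bounds and Gaussian tails -/

section Tails

variable {Ω : Type*} [MeasurableSpace Ω] {P : Measure Ω}

lemma measure_biUnion_le_ofReal {ι : Type*} (s : Finset ι) (A : ι → Set Ω) {b : ℝ}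
    (hA : ∀ i ∈ s, P (A i) ≤ ENNReal.ofReal b) :
    P (⋃ i ∈ s, A i) ≤ ENNReal.ofReal (s.card * b) := by
  refine (measure_biUnion_finset_le s A).trans ((Finset.sum_le_card_nsmul s _ _ hA).trans ?_)
  rw [nsmul_eq_mul, ENNReal.ofReal_mul (by positivity), ENNReal.ofReal_natCast]

/-- The constant in the tail estimate `IsCenteredGaussian.measure_le_abs_le`. -/
def tailConst (M : ℝ) (q : ℕ) : ℝ := 2 * q.factorial * Real.exp (M / 2)

lemma tailConst_pos (M : ℝ) (q : ℕ) : 0 < tailConst M q := by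
  unfold tailConst
  positivity

/-- Markov's inequality for the `q`-th moment of `X / s`. The order `q` is free, so the bound can
beat any polynomial number of grid points. -/
lemma IsCenteredGaussian.measure_le_abs_le {X : Ω → ℝ} {M s ε : ℝ} (h : IsCenteredGaussian X P)
    (hs : 0 < s) (hε : 0 < ε) (hM : ∫ ω, X ω ^ 2 ∂P ≤ s ^ 2 * M) (q : ℕ) :
    P {ω | ε ≤ |X ω|} ≤ ENNReal.ofReal (tailConst M q * (s / ε) ^ q) := by
  have h1 : IsCenteredGaussian (fun ω ↦ s⁻¹ * X ω) P :=
    ⟨h.1.fun_smul s⁻¹, by rw [integral_const_mul, h.2, mul_zero]⟩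
  have h2 : ∫ ω, (s⁻¹ * X ω) ^ 2 ∂P ≤ M := by
    simp_rw [mul_pow]
    rw [integral_const_mul, inv_pow, inv_mul_le_iff₀ (by positivity)]
    exact hM
  have h3 := h1.lintegral_pow_le h2 q
  have hm : AEMeasurable (fun ω ↦ ENNReal.ofReal (|s⁻¹ * X ω| ^ q)) P := by
    have := h.1.aemeasurable
    fun_prop
  have h4 := meas_ge_le_lintegral_div hm (ε := ENNReal.ofReal ((ε / s) ^ q))
    (by rw [ne_eq, ENNReal.ofReal_eq_zero, not_le]; positivity) ENNReal.ofReal_ne_top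
  refine (measure_mono fun ω hω ↦ ?_).trans (h4.trans ((ENNReal.div_le_div_right h3 _).trans ?_))
  · refine ENNReal.ofReal_le_ofReal (pow_le_pow_left₀ (by positivity) ?_ q)
    rw [abs_mul, abs_of_pos (by positivity : 0 < s⁻¹), div_eq_inv_mul]
    exact mul_le_mul_of_nonneg_left hω (by positivity)
  · rw [← ENNReal.ofReal_div_of_pos (by positivity)]
    refine ENNReal.ofReal_le_ofReal (le_of_eq ?_)
    rw [tailConst, ← inv_div ε s, inv_pow, div_eq_mul_inv]

end Tails

/-! ### Scales, grid steps and thresholds -/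

section Scales

/-- The basic scale `2^{-k}`. -/
def scale (k : ℕ) : ℝ := (1 / 2) ^ k

lemma scale_pos (k : ℕ) : 0 < scale k := by unfold scale; positivity

lemma scale_le_one (k : ℕ) : scale k ≤ 1 := pow_le_one₀ (by norm_num) (by norm_num)

lemma scale_le_half {k : ℕ} (hk : 1 ≤ k) : scale k ≤ 1 / 2 :=
  (pow_le_pow_of_le_one (by norm_num) (by norm_num) hk).trans (by norm_num)

lemma scale_succ (k : ℕ) : scale (k + 1) = scale k / 2 := by
  rw [scale, pow_succ, scale]; ring

lemma scale_add (k l : ℕ) : scale (k + l) = scale k * scale l := pow_add _ _ _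

lemma tendsto_scale : Tendsto scale atTop (𝓝 0) :=
  tendsto_pow_atTop_nhds_zero_of_lt_one (by norm_num) (by norm_num)

/-- The exponent relating the scale to the grid step. -/
def gridExp (n m : ℕ) : ℕ := 2 * (m + n)

/-- The step of the `k`-th grid. -/
def step (n m k : ℕ) : ℝ := scale k ^ gridExp n m

/-- The threshold at the `k`-th level. -/
def threshold (n m k : ℕ) : ℝ := scale k ^ (gridExp n m - 1)

lemma step_pos (n m k : ℕ) : 0 < step n m k := pow_pos (scale_pos k) _

lemma step_le_one (n m k : ℕ) : step n m k ≤ 1 := pow_le_one₀ (scale_pos k).le (scale_le_one k)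

lemma threshold_pos (n m k : ℕ) : 0 < threshold n m k := pow_pos (scale_pos k) _

/-- The ratio of step to threshold is the small factor behind both the increment bound and the net
error. Positivity of `n` keeps the subtraction in the exponent of `threshold` from truncating. -/
lemma step_eq {n m : ℕ} (hn : 0 < n) (k : ℕ) : step n m k = scale k * threshold n m k := by
  rw [step, threshold, ← pow_succ']
  congr 1
  unfold gridExp
  omega

end Scales

/-! ### Probabilities of the exceptional events -/

section Events

variable {Ω : Type*} [MeasurableSpace Ω] {P : Measure Ω} {n m : ℕ}
  {F : Ω → EuclideanSpace ℝ (Fin n) → EuclideanSpace ℝ (Fin m)} {R M k₁ : ℝ}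

/-- Some component of the field or of its gradient has a large increment between neighbouring
points of two consecutive grids. -/
def incrementEvent (F : Ω → EuclideanSpace ℝ (Fin n) → EuclideanSpace ℝ (Fin m)) (R : ℝ) (k : ℕ) :
    Set Ω :=
  ⋃ p ∈ (grid n R (step n m (k + 1)) ×ˢ grid n R (step n m k)) ×ˢ
      (Finset.univ : Finset (Option (Fin n) × Fin m)),
    {ω | (∀ j, |latticePoint (step n m (k + 1)) p.1.1 j - latticePoint (step n m k) p.1.2 j| ≤
        step n m k) ∧
      threshold n m k ≤ |fieldDeriv F p.2.1.toList p.2.2 (latticePoint (step n m (k + 1)) p.1.1) ω -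
        fieldDeriv F p.2.1.toList p.2.2 (latticePoint (step n m k) p.1.2) ω|}

/-- The constant in the bound for the probability of `incrementEvent`. -/
def incrementConst (n m : ℕ) (R M : ℝ) : ℝ :=
  (2 * R + 5) ^ n * (2 ^ gridExp n m) ^ n * (2 * R + 5) ^ n * ((n + 1) * m) *
    (tailConst M (2 * n * gridExp n m + 1) * n ^ (2 * n * gridExp n m + 1))

/-- In the chaining, `none` stands for a component of the field and `some j` for its derivative
`∂_j`, so both are treated at once. -/
lemma length_toList_le_one {α : Type*} (o : Option α) : o.toList.length ≤ 1 := by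
  cases o <;> simp

/-- All pairs of grid points are counted, of order `scale k ^ (-2 n N)` with `N = gridExp n m`. The
moment of order `q = 2 n N + 1` gives `(n * scale k) ^ q` for each, so one power of the scale
survives. -/
lemma Assumptions.measure_incrementEvent_le [IsProbabilityMeasure P]
    (h : Assumptions P F R M k₁) (hn : 0 < n) (hR : 0 < R) (k : ℕ) :
    P (incrementEvent F R k) ≤ ENNReal.ofReal (incrementConst n m R M * scale k) := by
  have hu := scale_pos k
  have hε := threshold_pos n m k
  have hst := step_pos n m k
  set q := 2 * n * gridExp n m + 1 with hq
  have hn' : (0 : ℝ) < n := by exact_mod_cast hn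
  have hc := tailConst_pos M q
  refine (measure_biUnion_le_ofReal (b := tailConst M q * (n * scale k) ^ q) _ _ ?_).trans
    (ENNReal.ofReal_le_ofReal ?_)
  · rintro ⟨⟨y, z⟩, o, i⟩ hp
    simp only [Finset.mem_product, Finset.mem_univ, and_true] at hp
    have hy := mem_openCube_of_mem_grid hp.1
    have hz := mem_openCube_of_mem_grid hp.2
    have ho := length_toList_le_one o
    by_cases hcl : ∀ j, |latticePoint (step n m (k + 1)) y j - latticePoint (step n m k) z j| ≤
        step n m k
    · have hg : IsCenteredGaussian (fieldDeriv F o.toList i (latticePoint (step n m (k + 1)) y) -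
          fieldDeriv F o.toList i (latticePoint (step n m k) z)) P :=
        h.isGaussianSpace 2 _ (Submodule.sub_mem _ (h.fieldDeriv_mem_two i (by omega) hy)
          (h.fieldDeriv_mem_two i (by omega) hz))
      have := hg.measure_le_abs_le (by positivity) hε (h.integral_sub_sq_le i ho hz hy hcl) q
      refine (measure_mono fun ω hω ↦ hω.2).trans (this.trans_eq ?_)
      rw [step_eq hn]
      congr 4
      field_simp
    -- For a pair that is not neighbouring the event is empty.
    · refine (measure_mono fun ω hω ↦ (hcl hω.1).elim).trans (b := P ∅) (by simp)
  · rw [Finset.card_product, Finset.card_product, Finset.card_univ]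
    simp only [Fintype.card_prod, Fintype.card_option, Fintype.card_fin]
    push_cast
    have c1 := card_grid_le n hR (step_pos n m (k + 1)) (step_le_one n m (k + 1))
    have c2 := card_grid_le n hR (step_pos n m k) (step_le_one n m k)
    calc ((grid n R (step n m (k + 1))).card * (grid n R (step n m k)).card * ((n + 1) * m) : ℝ) *
          (tailConst M q * (n * scale k) ^ q)
        ≤ (((2 * R + 5) / step n m (k + 1)) ^ n * ((2 * R + 5) / step n m k) ^ n *
            ((n + 1) * m)) * (tailConst M q * (n * scale k) ^ q) := by
          gcongr
          have := step_pos n m (k + 1)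
          positivity
      _ = incrementConst n m R M * scale k := by
          have e : scale k ^ q = (scale k ^ gridExp n m) ^ n * (scale k ^ gridExp n m) ^ n *
              scale k := by
            rw [hq, ← pow_mul, ← pow_add, ← pow_succ]
            congr 1
            ring
          rw [incrementConst, ← hq, mul_pow _ _ q, e, step, step, scale_succ]
          simp only [div_pow]
          field_simp

/-- Some first derivative is large at some point of the grid. -/
def jacobianEvent (F : Ω → EuclideanSpace ℝ (Fin n) → EuclideanSpace ℝ (Fin m)) (R : ℝ) (k : ℕ) :
    Set Ω :=
  ⋃ p ∈ grid n R (step n m k) ×ˢ (Finset.univ : Finset (Fin m × Fin n)),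
    {ω | (scale k)⁻¹ ≤ |fieldDeriv F [p.2.2] p.2.1 (latticePoint (step n m k) p.1) ω|}

/-- The constant in the bound for the probability of `jacobianEvent`. -/
def jacobianConst (n m : ℕ) (R M : ℝ) : ℝ :=
  (2 * R + 5) ^ n * (m * n) * tailConst M (n * gridExp n m + 1)

/-- Here only one grid is counted, so the moment of order `n N + 1` suffices, with `N = gridExp n
m`. -/
lemma Assumptions.measure_jacobianEvent_le [IsProbabilityMeasure P]
    (h : Assumptions P F R M k₁) (hR : 0 < R) (k : ℕ) :
    P (jacobianEvent F R k) ≤ ENNReal.ofReal (jacobianConst n m R M * scale k) := by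
  have hu := scale_pos k
  have hst := step_pos n m k
  set q := n * gridExp n m + 1 with hq
  have hc := tailConst_pos M q
  refine (measure_biUnion_le_ofReal (b := tailConst M q * scale k ^ q) _ _ ?_).trans
    (ENNReal.ofReal_le_ofReal ?_)
  · rintro ⟨z, i, j⟩ hp
    simp only [Finset.mem_product, Finset.mem_univ, and_true] at hp
    have hz := mem_openCube_of_mem_grid hp
    have hg := h.isGaussianSpace 2 _ (h.fieldDeriv_mem_two i (a := [j]) (by simp) hz)
    have := hg.measure_le_abs_le one_pos (inv_pos.mpr hu)
      (by simpa using h.integral_sq_le i (a := [j]) (by simp) hz) q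
    simpa using this
  · rw [Finset.card_product, Finset.card_univ]
    simp only [Fintype.card_prod, Fintype.card_fin]
    push_cast
    have c2 := card_grid_le n hR (step_pos n m k) (step_le_one n m k)
    calc ((grid n R (step n m k)).card * (m * n) : ℝ) * (tailConst M q * scale k ^ q)
        ≤ (((2 * R + 5) / step n m k) ^ n * (m * n)) * (tailConst M q * scale k ^ q) := by
          gcongr
      _ = jacobianConst n m R M * scale k := by
          have e : scale k ^ q = (scale k ^ gridExp n m) ^ n * scale k := by
            rw [hq, ← pow_mul, ← pow_succ]
            congr 1
            ring
          rw [jacobianConst, ← hq, e, step]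
          simp only [div_pow]
          field_simp

/-- Nondegeneracy on the unit sphere, extended to all coefficients by homogeneity. -/
lemma Assumptions.le_integral_sq (h : Assumptions P F R M k₁) {x : EuclideanSpace ℝ (Fin n)}
    (hx : x ∈ openCube n (R + 1)) (η : Fin m → ℝ) (ξ : Fin m → Fin n → ℝ) :
    k₁ * (∑ i, η i ^ 2 + ∑ i, ∑ j, ξ i j ^ 2) ≤
      ∫ ω, (∑ i, η i * fieldDeriv F [] i x ω +
        ∑ i, ∑ j, ξ i j * fieldDeriv F [j] i x ω) ^ 2 ∂P := by
  set s := ∑ i, η i ^ 2 + ∑ i, ∑ j, ξ i j ^ 2 with hs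
  have hs0 : 0 ≤ s := by positivity
  rcases hs0.eq_or_lt with h0 | hpos
  · rw [← h0, mul_zero]
    exact integral_nonneg fun ω ↦ sq_nonneg _
  · have hr := Real.sqrt_pos.mpr hpos
    have hr2 := Real.sq_sqrt hs0
    have h1 := h.nondegenerate.2 x hx (fun i ↦ η i / √s) (fun i j ↦ ξ i j / √s) (by
      simp_rw [div_pow, ← Finset.sum_div, hr2, ← add_div]
      exact div_self hpos.ne')
    have e : ∀ ω, |∑ i, η i / √s * F ω x i +
        ∑ i, ∑ j, ξ i j / √s * pderiv j (fun y ↦ F ω y i) x| ^ 2 =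
        (∑ i, η i * fieldDeriv F [] i x ω +
        ∑ i, ∑ j, ξ i j * fieldDeriv F [j] i x ω) ^ 2 / s := by
      intro ω
      rw [sq_abs, ← hr2, ← div_pow, add_div]
      simp_rw [Finset.sum_div, div_mul_eq_mul_div]
      rw [hr2]
      rfl
    simp_rw [e] at h1
    rwa [integral_div, le_div_iff₀ hpos] at h1

/-- At some point of the grid and for some vector of the net, the field and the gradient of its
scalar product with the vector are both small. -/
def smallEvent (F : Ω → EuclideanSpace ℝ (Fin n) → EuclideanSpace ℝ (Fin m)) (R : ℝ) (k : ℕ) :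
    Set Ω :=
  ⋃ p ∈ grid n R (step n m k) ×ˢ (Finset.univ.sigma fun i₀ : Fin m ↦ net m (step n m k) i₀),
    {ω | (∀ i, |fieldDeriv F [] i (latticePoint (step n m k) p.1) ω| ≤ 4 * m * threshold n m k) ∧
      ∀ j, |∑ i, netVector (step n m k) p.2.1 p.2.2 i *
        fieldDeriv F [j] i (latticePoint (step n m k) p.1) ω| ≤ 4 * m * threshold n m k}

/-- The constant in the bound for the probability of `smallEvent`. -/
def smallConst (n m : ℕ) (R k₁ : ℝ) : ℝ :=
  (2 * R + 5) ^ (n + (m - 1)) * m * (Real.exp (1 / 2) * (4 * m / √k₁)) ^ (m + n)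

/-- A combination of the `m + n` variables with coefficients `z` has Jacobian coefficients `ξ i j =
w i * z j`. The normalization `w i₀ = 1` makes their square sum at least that of the `z j`, so the
covariance is still bounded below by `k₁`, uniformly in `w`. -/
lemma Assumptions.measure_small_le [IsProbabilityMeasure P] (h : Assumptions P F R M k₁)
    {x : EuclideanSpace ℝ (Fin n)} (hx : x ∈ openCube n (R + 1)) {w : Fin m → ℝ} {i₀ : Fin m}
    (hw : w i₀ = 1) {ε : ℝ} (hε : 0 < ε) :
    P {ω | (∀ i, |fieldDeriv F [] i x ω| ≤ ε) ∧ ∀ j, |∑ i, w i * fieldDeriv F [j] i x ω| ≤ ε} ≤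
      ENNReal.ofReal ((Real.exp (1 / 2) * (ε / √k₁)) ^ (m + n)) := by
  have key := measure_forall_abs_le_le (P := P) (ι := Fin m ⊕ Fin n) (k := k₁) (ε := ε)
    (X := Sum.elim (fun i ↦ fieldDeriv F [] i x)
      fun j ω ↦ ∑ i, w i * fieldDeriv F [j] i x ω) h.nondegenerate.1 hε (fun z ↦ ?_) fun z ↦ ?_
  · simpa using key
  · refine h.isGaussianSpace 2 _ ?_
    have hmem : ∑ i, z (Sum.inl i) • fieldDeriv F [] i x +
        ∑ j, z (Sum.inr j) • ∑ i, w i • fieldDeriv F [j] i x ∈ derivSpace P F R 2 :=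
      Submodule.add_mem _
        (Submodule.sum_mem _ fun i _ ↦ Submodule.smul_mem _ _
          (h.fieldDeriv_mem_two i (by simp) hx))
        (Submodule.sum_mem _ fun j _ ↦ Submodule.smul_mem _ _
          (Submodule.sum_mem _ fun i _ ↦ Submodule.smul_mem _ _
            (h.fieldDeriv_mem_two i (by simp) hx)))
    convert hmem using 1
    ext ω
    simp
  · have h1 := h.le_integral_sq hx (fun i ↦ z (Sum.inl i)) fun i j ↦ w i * z (Sum.inr j)
    have e : ∀ ω, ∑ i, z (Sum.inl i) * fieldDeriv F [] i x ω +
        ∑ i, ∑ j, w i * z (Sum.inr j) * fieldDeriv F [j] i x ω =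
        ∑ a, z a * Sum.elim (fun i ↦ fieldDeriv F [] i x)
          (fun j ω ↦ ∑ i, w i * fieldDeriv F [j] i x ω) a ω := by
      intro ω
      rw [Fintype.sum_sum_type, Finset.sum_comm]
      simp only [Sum.elim_inl, Sum.elim_inr, Finset.mul_sum]
      congr 1
      refine Finset.sum_congr rfl fun j _ ↦ Finset.sum_congr rfl fun i _ ↦ by ring
    simp_rw [e] at h1
    refine le_trans ?_ h1
    refine mul_le_mul_of_nonneg_left ?_ h.nondegenerate.1.le
    rw [Fintype.sum_sum_type]
    gcongr
    calc ∑ j, z (Sum.inr j) ^ 2 = ∑ j, (w i₀ * z (Sum.inr j)) ^ 2 := by simp [hw]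
      _ ≤ ∑ i, ∑ j, (w i * z (Sum.inr j)) ^ 2 :=
          Finset.single_le_sum (f := fun i ↦ ∑ j, (w i * z (Sum.inr j)) ^ 2)
            (fun i _ ↦ by positivity) (Finset.mem_univ i₀)

/-- This is where `gridExp = 2 (m + n)` comes from: the threshold loses `scale k ^ (-(m + n))`
against the step, the spare power of the step is `scale k ^ (2 (m + n))`, and half of it remains. -/
lemma threshold_pow_eq (hn : 0 < n) (k : ℕ) :
    threshold n m k ^ (m + n) = step n m k ^ (m + n - 1) * scale k ^ (m + n) := by
  have hu := pow_pos (scale_pos k) (m + n)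
  refine mul_right_cancel₀ hu.ne' ?_
  rw [← mul_pow, mul_comm (threshold n m k), ← step_eq hn, mul_assoc, ← pow_add]
  have : scale k ^ (m + n + (m + n)) = step n m k := by
    rw [step, gridExp, two_mul]
  rw [this, ← pow_succ]
  congr 1
  omega

/-- Grid and net together have order `step ^ (-(m + n - 1))` elements, which cancels the power of
the step in `threshold_pow_eq` exactly. -/
lemma Assumptions.measure_smallEvent_le [IsProbabilityMeasure P]
    (h : Assumptions P F R M k₁) (hn : 0 < n) (hm : 0 < m) (hR : 0 < R) (k : ℕ) :
    P (smallEvent F R k) ≤ ENNReal.ofReal (smallConst n m R k₁ * scale k) := by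
  have hu := scale_pos k
  have hst := step_pos n m k
  have hε := threshold_pos n m k
  have hk₁ := Real.sqrt_pos.mpr h.nondegenerate.1
  have hm' : (0 : ℝ) < m := by exact_mod_cast hm
  refine (measure_biUnion_le_ofReal
    (b := (Real.exp (1 / 2) * (4 * m * threshold n m k / √k₁)) ^ (m + n)) _ _ ?_).trans
    (ENNReal.ofReal_le_ofReal ?_)
  · rintro ⟨z, i₀, w⟩ hp
    exact h.measure_small_le (mem_openCube_of_mem_grid (Finset.mem_product.mp hp).1)
      (i₀ := i₀) (by simp [netVector]) (by positivity)
  · rw [Finset.card_product, Finset.card_sigma]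
    push_cast
    have c1 : ∑ i₀, ((net m (step n m k) i₀).card : ℝ) ≤
        m * ((2 * R + 5) / step n m k) ^ (m - 1) := by
      refine (Finset.sum_le_sum fun i₀ _ ↦ card_net_le hR hst (step_le_one n m k) i₀).trans_eq ?_
      simp
    have c2 := card_grid_le n hR hst (step_le_one n m k)
    have e1 : Real.exp (1 / 2) * (4 * m * threshold n m k / √k₁) =
        Real.exp (1 / 2) * (4 * m / √k₁) * threshold n m k := by ring
    have e2 : m + n - 1 = n + (m - 1) := by omega
    calc _ ≤ ((2 * R + 5) / step n m k) ^ n * (m * ((2 * R + 5) / step n m k) ^ (m - 1)) *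
          (Real.exp (1 / 2) * (4 * m * threshold n m k / √k₁)) ^ (m + n) := by
          gcongr
      _ = smallConst n m R k₁ * scale k ^ (m + n) := by
          rw [smallConst, e1, mul_pow _ _ (m + n), threshold_pow_eq hn, e2]
          simp only [div_pow, pow_add]
          field_simp
      _ ≤ smallConst n m R k₁ * scale k := by
          have : 0 ≤ smallConst n m R k₁ := by unfold smallConst; positivity
          gcongr
          exact pow_le_of_le_one hu.le (scale_le_one k) (by omega)

end Events

/-! ### Chaining and reduction to grid and net -/

section Deterministic

variable {Ω : Type*} {n m : ℕ} {F : Ω → EuclideanSpace ℝ (Fin n) → EuclideanSpace ℝ (Fin m)}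
  {R : ℝ} {ω : Ω}

lemma closedCube_subset_openCube : closedCube n R ⊆ openCube n (R + 1) := by
  intro x hx i
  exact ⟨by linarith [(hx i).1], by linarith [(hx i).2]⟩

lemma scale_lt_one {k : ℕ} (hk : 1 ≤ k) : scale k < 1 :=
  (scale_le_half hk).trans_lt (by norm_num)

lemma gridExp_ne_zero (hn : 0 < n) : gridExp n m ≠ 0 := by
  unfold gridExp
  omega

lemma step_lt_one (hn : 0 < n) {k : ℕ} (hk : 1 ≤ k) : step n m k < 1 :=
  pow_lt_one₀ (scale_pos k).le (scale_lt_one hk) (gridExp_ne_zero hn)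

lemma tendsto_step (hn : 0 < n) : Tendsto (step n m) atTop (𝓝 0) := by
  have := tendsto_scale.pow (gridExp n m)
  rwa [zero_pow (gridExp_ne_zero hn)] at this

lemma step_antitone : Antitone (step n m) := fun k l hkl ↦
  pow_le_pow_left₀ (scale_pos l).le
    (pow_le_pow_of_le_one (by norm_num) (by norm_num) hkl) _

lemma threshold_add_le (hn : 0 < n) (k l : ℕ) :
    threshold n m (k + l) ≤ threshold n m k / 2 ^ l := by
  rw [threshold, threshold, scale_add, mul_pow, div_eq_mul_inv]
  refine mul_le_mul_of_nonneg_left ?_ (pow_pos (scale_pos k) _).le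
  refine (pow_le_of_le_one (scale_pos l).le (scale_le_one l) ?_).trans_eq ?_
  · unfold gridExp
    omega
  · simp [scale]

/-- Off the increment events, the value at a point is close to the value at the rounded point. -/
lemma abs_fieldDeriv_sub_roundDown_le (hn : 0 < n) {K : ℕ} (hK : 1 ≤ K)
    (hinc : ∀ l, ω ∉ incrementEvent F R (K + l)) {o : Option (Fin n)} {i : Fin m}
    (hcont : ContinuousOn (fun x ↦ fieldDeriv F o.toList i x ω) (openCube n (R + 1)))
    {x : EuclideanSpace ℝ (Fin n)} (hx : x ∈ closedCube n R) :
    |fieldDeriv F o.toList i (latticePoint (step n m K) (roundDown (step n m K) x)) ω -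
      fieldDeriv F o.toList i x ω| ≤ 2 * threshold n m K := by
  have hxU := closedCube_subset_openCube hx
  set f : ℕ → ℝ := fun l ↦ fieldDeriv F o.toList i
    (latticePoint (step n m (K + l)) (roundDown (step n m (K + l)) x)) ω with hf
  have hlim : Tendsto f atTop (𝓝 (fieldDeriv F o.toList i x ω)) := by
    have h1 := tendsto_latticePoint_roundDown (h := fun l ↦ step n m (K + l))
      (fun l ↦ step_pos n m _)
      ((tendsto_step hn).comp (tendsto_atTop_mono (fun l ↦ Nat.le_add_left l K) tendsto_id)) x
    exact (hcont.continuousAt ((isOpen_openCube _).mem_nhds hxU)).tendsto.comp h1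
  -- The bound `ε / 2 ^ l` on consecutive differences is written as `2 * ε / 2 / 2 ^ l`, the form
  -- whose sum over all levels is `2 * ε`.
  have hstep : ∀ l, dist (f l) (f (l + 1)) ≤ 2 * threshold n m K / 2 / 2 ^ l := by
    intro l
    rw [mul_div_cancel_left₀ _ two_ne_zero]
    refine le_trans ?_ (threshold_add_le hn K l)
    by_contra! hcon
    refine hinc l ?_
    have s1 : step n m (K + l + 1) < 1 := step_lt_one hn (by omega)
    have s2 : step n m (K + l) < 1 := step_lt_one hn (by omega)
    have p1 := step_pos n m (K + l + 1)
    have p2 := step_pos n m (K + l)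
    rw [incrementEvent]
    refine Set.mem_biUnion (x := ((roundDown (step n m (K + l + 1)) x,
      roundDown (step n m (K + l)) x), (o, i))) ?_ ⟨fun j ↦ ?_, ?_⟩
    · simp only [Finset.coe_product, Set.mem_prod, Finset.mem_coe, Finset.mem_univ, and_true]
      exact ⟨roundDown_mem_grid p1 s1 hx, roundDown_mem_grid p2 s2 hx⟩
    · have h1 := mul_floor_div_le p1 (x j)
      have h2 := lt_mul_floor_div_add p1 (x j)
      have h3 := mul_floor_div_le p2 (x j)
      have h4 := lt_mul_floor_div_add p2 (x j)
      have h5 : step n m (K + l + 1) ≤ step n m (K + l) := step_antitone (Nat.le_succ _)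
      simp only [latticePoint_apply, roundDown]
      rw [abs_le]
      constructor <;> linarith
    · rw [dist_comm, Real.dist_eq] at hcon
      exact hcon.le
  exact dist_le_of_le_geometric_two_of_tendsto₀ hstep hlim

lemma gradient_inner_apply {G : EuclideanSpace ℝ (Fin n) → EuclideanSpace ℝ (Fin m)}
    {x : EuclideanSpace ℝ (Fin n)} (hG : DifferentiableAt ℝ G x) (w : EuclideanSpace ℝ (Fin m))
    (j : Fin n) :
    (gradient (fun y ↦ inner ℝ (G y) w) x) j = ∑ i, w i * pderiv j (fun y ↦ G y i) x := by
  have hGi : ∀ i, DifferentiableAt ℝ (fun y ↦ G y i) x := fun i ↦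
    (differentiableAt_euclidean.mp hG) i
  have h1 : (gradient (fun y ↦ inner ℝ (G y) w) x) j =
      fderiv ℝ (fun y ↦ inner ℝ (G y) w) x (EuclideanSpace.single j 1) := by
    rw [← inner_gradient_left, EuclideanSpace.inner_single_right]
    simp
  have h2 : (fun y ↦ inner ℝ (G y) w) = fun y ↦ ∑ i, w i * G y i := by
    ext y
    simp [PiLp.inner_apply]
  rw [h1, h2, fderiv_fun_sum fun i _ ↦ (hGi i).const_mul _, sum_apply]
  refine Finset.sum_congr rfl fun i _ ↦ ?_
  rw [fderiv_const_mul (hGi i), pderiv, (hGi i).lineDeriv_eq_fderiv]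
  rfl

/-- The maximal coordinate of a unit vector in `ℝ^m` is at least `1 / m`. -/
lemma exists_abs_coord_ge (w : EuclideanSpace ℝ (Fin m)) (hw : ‖w‖ = 1) :
    ∃ i₀, (∀ i, |w i| ≤ |w i₀|) ∧ 1 ≤ m * |w i₀| := by
  have hne : Nonempty (Fin m) := by
    by_contra hcon
    rw [not_nonempty_iff] at hcon
    have : w = 0 := Subsingleton.elim _ _
    simp [this] at hw
  obtain ⟨i₀, hi₀⟩ := Finite.exists_max fun i ↦ |w i|
  refine ⟨i₀, hi₀, ?_⟩
  have h1 : ∑ i, w i ^ 2 = 1 := by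
    have := EuclideanSpace.real_norm_sq_eq w
    rw [hw] at this
    linarith
  have h2 : |w i₀| ≤ 1 := by
    have := Finset.single_le_sum (f := fun i ↦ w i ^ 2) (fun i _ ↦ sq_nonneg _)
      (Finset.mem_univ i₀)
    rw [h1] at this
    exact (sq_le_one_iff_abs_le_one _).mp this
  have h3 : ∑ i, w i ^ 2 ≤ ∑ _i : Fin m, |w i₀| := by
    refine Finset.sum_le_sum fun i _ ↦ ?_
    rw [← sq_abs]
    nlinarith [hi₀ i, abs_nonneg (w i), abs_nonneg (w i₀)]
  rw [h1] at h3
  simpa using h3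

/-- A point violating the bound would put `ω` in `smallEvent`. The constant `4 m` in that event
collects, for the gradient, `m ε` from normalizing the direction, `2 m ε` from chaining and `m ε`
from rounding the direction to the net. -/
lemma le_sInf_of_notMem (hn : 0 < n) (hm : 0 < m) (hR : 0 < R) {K : ℕ} (hK : 1 ≤ K)
    (hinc : ∀ l, ω ∉ incrementEvent F R (K + l)) (hjac : ω ∉ jacobianEvent F R K)
    (hsmall : ω ∉ smallEvent F R K)
    (hcont : ∀ (o : Option (Fin n)) (i : Fin m),
      ContinuousOn (fun x ↦ fieldDeriv F o.toList i x ω) (openCube n (R + 1)))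
    (hdiff : ∀ x ∈ openCube n (R + 1), DifferentiableAt ℝ (F ω) x) :
    threshold n m K ≤ sInf ((fun x ↦ max ‖F ω x‖ (lam (F ω) x)) '' closedCube n R) := by
  set ε := threshold n m K with hεdef
  set h := step n m K with hhdef
  have hε : 0 < ε := threshold_pos n m K
  have h0 : 0 < h := step_pos n m K
  have h1 : h < 1 := step_lt_one hn hK
  have hm1 : (1 : ℝ) ≤ m := by exact_mod_cast hm
  have hhε : h = scale K * ε := step_eq hn K
  refine le_csInf (Set.Nonempty.image _ ⟨0, fun i ↦ by simp [hR.le]⟩) ?_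
  rintro _ ⟨x, hx, rfl⟩
  by_contra! hcon
  obtain ⟨hF, hlam⟩ := max_lt_iff.mp hcon
  have hxU := closedCube_subset_openCube hx
  have : Nonempty (Fin m) := ⟨⟨0, hm⟩⟩
  obtain ⟨_, ⟨w, hw, rfl⟩, hgrad⟩ := exists_lt_of_csInf_lt
    (Set.Nonempty.image _ (NormedSpace.sphere_nonempty.mpr zero_le_one)) hlam
  rw [mem_sphere_zero_iff_norm] at hw
  obtain ⟨i₀, hmax, hi₀⟩ := exists_abs_coord_ge w hw
  have hpos : 0 < |w i₀| := by
    by_contra! hcon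
    nlinarith
  have hne : w i₀ ≠ 0 := abs_pos.mp hpos
  -- Dividing by the largest coordinate, which is at least `1 / m` in modulus, puts the direction in
  -- the cube with one coordinate equal to `1`, at the cost of a factor `m` in the gradient bound.
  set v : Fin m → ℝ := fun i ↦ w i / w i₀ with hv
  have hv1 : ∀ i, |v i| ≤ 1 := fun i ↦ by
    rw [hv, abs_div]
    exact div_le_one_of_le₀ (hmax i) hpos.le
  obtain ⟨z, hz, hzv⟩ := exists_mem_net h0 i₀ hv1 (div_self hne)
  set y := latticePoint h (roundDown h x) with hy
  have hgridmem := roundDown_mem_grid (n := n) (R := R) h0 h1 hx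
  have happrox : ∀ (o : Option (Fin n)) (i : Fin m),
      |fieldDeriv F o.toList i y ω - fieldDeriv F o.toList i x ω| ≤ 2 * ε :=
    fun o i ↦ abs_fieldDeriv_sub_roundDown_le hn hK hinc (hcont o i) hx
  have hbound : ∀ i j, |fieldDeriv F [j] i y ω| ≤ (scale K)⁻¹ := by
    intro i j
    by_contra! hcon
    refine hjac ?_
    rw [jacobianEvent]
    exact Set.mem_biUnion (x := (roundDown h x, (i, j)))
      (by simpa using hgridmem) hcon.le
  have hvx : ∀ j, |∑ i, v i * fieldDeriv F [j] i x ω| ≤ m * ε := by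
    intro j
    have e1 := gradient_inner_apply (hdiff x hxU) w j
    have e2 : |∑ i, w i * fieldDeriv F [j] i x ω| ≤ ε := by
      have : ∑ i, w i * fieldDeriv F [j] i x ω =
          (gradient (fun y ↦ inner ℝ (F ω y) w) x) j := e1.symm
      rw [this, ← Real.norm_eq_abs]
      exact (PiLp.norm_apply_le _ j).trans hgrad.le
    have e3 : ∑ i, v i * fieldDeriv F [j] i x ω =
        (∑ i, w i * fieldDeriv F [j] i x ω) / w i₀ := by
      rw [Finset.sum_div]
      exact Finset.sum_congr rfl fun i _ ↦ by rw [hv]; ring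
    rw [e3, abs_div, div_le_iff₀ hpos]
    nlinarith
  refine hsmall ?_
  rw [smallEvent]
  refine Set.mem_biUnion (x := (roundDown h x, ⟨i₀, z⟩)) (by simpa using ⟨hgridmem, hz⟩)
    ⟨fun i ↦ ?_, fun j ↦ ?_⟩
  · have e1 := happrox none i
    have e2 : |fieldDeriv F [] i x ω| ≤ ‖F ω x‖ := PiLp.norm_apply_le (F ω x) i
    simp only [Option.toList_none] at e1
    have e3 := abs_sub_abs_le_abs_sub (fieldDeriv F [] i y ω) (fieldDeriv F [] i x ω)
    change |fieldDeriv F [] i y ω| ≤ 4 * m * ε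
    nlinarith
  · change |∑ i, netVector h i₀ z i * fieldDeriv F [j] i y ω| ≤ 4 * m * ε
    -- The first correction moves the point while keeping the direction; the second moves the
    -- direction at the grid point, where the Jacobian is at most `(scale K)⁻¹`.
    have e : ∑ i, netVector h i₀ z i * fieldDeriv F [j] i y ω =
        ∑ i, v i * fieldDeriv F [j] i x ω +
        ∑ i, (v i * (fieldDeriv F [j] i y ω - fieldDeriv F [j] i x ω) -
          (v i - netVector h i₀ z i) * fieldDeriv F [j] i y ω) := by
      rw [← Finset.sum_add_distrib]
      exact Finset.sum_congr rfl fun i _ ↦ by ring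
    rw [e]
    refine (abs_add_le _ _).trans ?_
    have e4 : |∑ i, (v i * (fieldDeriv F [j] i y ω - fieldDeriv F [j] i x ω) -
          (v i - netVector h i₀ z i) * fieldDeriv F [j] i y ω)| ≤ ∑ _i : Fin m, 3 * ε := by
      refine (Finset.abs_sum_le_sum_abs _ _).trans (Finset.sum_le_sum fun i _ ↦ ?_)
      refine (abs_sub _ _).trans ?_
      rw [abs_mul, abs_mul]
      have e5 : |v i| * |fieldDeriv F [j] i y ω - fieldDeriv F [j] i x ω| ≤ 1 * (2 * ε) :=
        mul_le_mul (hv1 i) (happrox (some j) i) (abs_nonneg _) zero_le_one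
      have e6 : |v i - netVector h i₀ z i| * |fieldDeriv F [j] i y ω| ≤ h * (scale K)⁻¹ :=
        mul_le_mul (hzv i) (hbound i j) (abs_nonneg _) h0.le
      have e7 : h * (scale K)⁻¹ = ε := by
        have := (scale_pos K).ne'
        rw [hhε]
        field_simp
      linarith
    have e8 : ∑ _i : Fin m, 3 * ε = m * (3 * ε) := by simp
    have := hvx j
    linarith

end Deterministic

/-! ### Summation over levels and the final estimate -/

section Main

variable {Ω : Type*} [MeasurableSpace Ω] {P : Measure Ω} {n m : ℕ}
  {F : Ω → EuclideanSpace ℝ (Fin n) → EuclideanSpace ℝ (Fin m)} {R M k₁ : ℝ}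

lemma incrementConst_nonneg (hR : 0 < R) : 0 ≤ incrementConst n m R M := by
  have := tailConst_pos M (2 * n * gridExp n m + 1)
  unfold incrementConst
  positivity

lemma Assumptions.measure_iUnion_incrementEvent_le [IsProbabilityMeasure P]
    (h : Assumptions P F R M k₁) (hn : 0 < n) (hR : 0 < R) (K : ℕ) :
    P (⋃ l, incrementEvent F R (K + l)) ≤
      ENNReal.ofReal (2 * incrementConst n m R M * scale K) := by
  have hc : 0 ≤ incrementConst n m R M := incrementConst_nonneg hR
  have hs : HasSum (fun l ↦ incrementConst n m R M * scale (K + l))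
      (2 * incrementConst n m R M * scale K) := by
    have := hasSum_geometric_two.mul_left (incrementConst n m R M * scale K)
    have e : (fun l ↦ incrementConst n m R M * scale (K + l)) =
        fun l ↦ incrementConst n m R M * scale K * (1 / 2) ^ l := by
      ext l
      rw [scale_add, ← mul_assoc]
      rfl
    rwa [e, mul_assoc 2, mul_comm 2]
  calc P (⋃ l, incrementEvent F R (K + l)) ≤ ∑' l, P (incrementEvent F R (K + l)) :=
        measure_iUnion_le _
    _ ≤ ∑' l, ENNReal.ofReal (incrementConst n m R M * scale (K + l)) :=
        ENNReal.tsum_le_tsum fun l ↦ h.measure_incrementEvent_le hn hR _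
    _ = _ := by
        rw [← ENNReal.ofReal_tsum_of_nonneg
          (fun l ↦ mul_nonneg hc (scale_pos _).le) hs.summable, hs.tsum_eq]

/-- The constant in the final estimate. -/
def totalConst (n m : ℕ) (R M k₁ : ℝ) : ℝ :=
  2 * incrementConst n m R M + jacobianConst n m R M + smallConst n m R k₁

lemma Assumptions.measure_sInf_lt_le [IsProbabilityMeasure P]
    (h : Assumptions P F R M k₁) (hn : 0 < n) (hm : 0 < m) (hR : 0 < R) {K : ℕ} (hK : 1 ≤ K) :
    P {ω | sInf ((fun x ↦ max ‖F ω x‖ (lam (F ω) x)) '' closedCube n R) < threshold n m K} ≤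
      ENNReal.ofReal (totalConst n m R M k₁ * scale K) := by
  have hu := scale_pos K
  have hreg := h.contDiffOn
  have hsub : {ω | sInf ((fun x ↦ max ‖F ω x‖ (lam (F ω) x)) '' closedCube n R) <
      threshold n m K} ≤ᵐ[P] (((⋃ l, incrementEvent F R (K + l)) ∪ jacobianEvent F R K) ∪
        smallEvent F R K : Set Ω) := by
    -- The inclusion is needed only for almost every `ω`, those with regular paths, and the bad set
    -- itself need not be measurable.
    filter_upwards [hreg] with ω hω hlt
    by_contra hcon
    have hcon' : ω ∉ ((⋃ l, incrementEvent F R (K + l)) ∪ jacobianEvent F R K) ∪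
        smallEvent F R K := hcon
    simp only [Set.mem_union, Set.mem_iUnion, not_or, not_exists] at hcon'
    refine absurd hlt (not_lt.mpr (le_sInf_of_notMem hn hm hR hK hcon'.1.1 hcon'.1.2 hcon'.2
      (fun o i ↦ (hω o.toList 0 i ?_).continuousOn) fun x hx ↦ ?_))
    · have := length_toList_le_one o
      omega
    · rw [differentiableAt_euclidean]
      intro i
      exact ((hω [] 1 i (by simp)).contDiffAt
        ((isOpen_openCube _).mem_nhds hx)).differentiableAt (by simp)
  refine (measure_mono_ae hsub).trans ?_
  have hi : 0 ≤ incrementConst n m R M := incrementConst_nonneg hR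
  have hj : 0 ≤ jacobianConst n m R M := by
    have := tailConst_pos M (n * gridExp n m + 1)
    unfold jacobianConst
    positivity
  have hs : 0 ≤ smallConst n m R k₁ := by
    unfold smallConst
    positivity
  rw [totalConst, add_mul, add_mul, ENNReal.ofReal_add (by positivity) (by positivity),
    ENNReal.ofReal_add (by positivity) (by positivity)]
  refine (measure_union_le _ _).trans (add_le_add ((measure_union_le _ _).trans (add_le_add ?_ ?_))
    ?_)
  · exact h.measure_iUnion_incrementEvent_le hn hR K
  · exact h.measure_jacobianEvent_le hR K
  · exact h.measure_smallEvent_le hn hm hR K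

end Main

end GaussianField

end

theorem mainTheorem9 (n m : ℕ) (hm : 0 < m) (hmn : m < n) (R M k₁ δ : ℝ)
    (hR : 0 < R) (hk₁ : 0 < k₁) (hδ : 0 < δ) :
    ∃ τ : ℝ, 0 < τ ∧ τ < 1 / 2 ∧
      ∀ (Ω : Type*) [MeasurableSpace Ω] (P : Measure Ω) [IsProbabilityMeasure P]
        (F : Ω → EuclideanSpace ℝ (Fin n) → EuclideanSpace ℝ (Fin m)),
        GaussianField.Assumptions P F R M k₁ →
        P {ω | sInf ((fun x ↦ max ‖F ω x‖ (GaussianField.lam (F ω) x)) ''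
          GaussianField.closedCube n R) < τ} < ENNReal.ofReal δ := by
  -- `totalConst` depends only on `n`, `m`, `R`, `M`, `k₁`, so the level `K` is chosen before the
  -- field.
  have hlim := GaussianField.tendsto_scale.const_mul (GaussianField.totalConst n m R M k₁)
  rw [mul_zero] at hlim
  obtain ⟨K, hKδ, hK⟩ :=
    ((hlim.eventually (gt_mem_nhds hδ)).and (Filter.eventually_ge_atTop 1)).exists
  refine ⟨GaussianField.threshold n m K, GaussianField.threshold_pos n m K, ?_, ?_⟩
  -- A single power of the scale would give only `≤ 1 / 2`; the square makes the inequality strict.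
  · calc GaussianField.threshold n m K ≤ GaussianField.scale K ^ 2 :=
          pow_le_pow_of_le_one (GaussianField.scale_pos K).le (GaussianField.scale_le_one K)
            (by unfold GaussianField.gridExp; omega)
      _ ≤ (1 / 2) ^ 2 :=
          pow_le_pow_left₀ (GaussianField.scale_pos K).le (GaussianField.scale_le_half hK) 2
      _ < 1 / 2 := by norm_num
  · intro Ω _ P _ F h
    exact (h.measure_sInf_lt_le (hm.trans hmn) hm hR hK).trans_lt
      ((ENNReal.ofReal_lt_ofReal_iff hδ).mpr hKδ)
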